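/- Let $(X,d)$ be a metric space. For $h\ge 0$, an $h$-short segment from $x$ to $y$ is a path $\gamma:[0,L]\to X$ ($L\ge 0$) from $x$ to $y$ with $\mathrm{len}(\gamma)\ge d(x,y)\ge \mathrm{len}(\gamma)-h$; $X$ is a length space if any two of its points are joined by an $h$-short segment for every $h>0$. Let $C>0$ and $H:X^3\to(0,\infty)$. A length space $X$ is $C$-rough CAT(0) with respect to $H$ if $d(u,v)\le|\bar u-\bar v|+C$ whenever: $x_1,x_2,x_3\in X$; $u,v$ are points on different sides of a triangle formed by $h$-short segments $[x_1,x_2]_h$, $[x_2,x_3]_h$, $[x_3,x_1]_h$, where $h=H(x_1,x_2,x_3)$; $\bar x_1,\bar x_2,\bar x_3\in\mathbb R^2$ satisfy $|\bar x_i-\bar x_j|=d(x_i,x_j)$ for all $i,j$; and $\bar u,\bar v$ are comparison points for $u,v$. Here a comparison point for $u\in[x_i,x_j]_h$ is any point $\bar u$ of the Euclidean segment $[\bar x_i,\bar x_j]$ with $|\bar x_i-\bar u|\le \mathrm{len}([x_i,u]_h)$ and $|\bar u-\bar x_j|\le \mathrm{len}([u,x_j]_h)$, the lengths being those of the two subpaths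 into which $u$ divides the side. The space $X$ is $C$-rough CAT(0) if this holds for $H(x,y,z)=1/\max\{1,d(x,y),d(x,z),d(y,z)\}$, and weakly $C$-rough CAT(0) if it holds for some function $H:X^3\to(0,\infty)$. For $n\ge 3$ and $C\ge 0$, $X$ satisfies the $C$-rough $n$-point condition if for all $x_1,\dots,x_n\in X$ there are $\bar x_1,\dots,\bar x_n\in\mathbb R^2$ such that, with $x_0=x_n$ and $\bar x_0=\bar x_n$: $d(x_i,x_{i-1})=|\bar x_i-\bar x_{i-1}|$ for $1\le i\le n$; $d(x_1,x_i)\le|\bar x_1-\bar x_i|$ for $2\le i\le n$; and $d(x_i,x_j)\le|\bar x_i-\bar x_j|+C$ for $2\le i,j\le n$. **Theorem.** Let $(X,d)$ be a length space. If $n\ge 5$ and $X$ satisfies the $C$-rough $n$-point condition for some $C\ge 0$, then $X$ is $(C+2\sqrt3)$-rough CAT(0), and it is weakly $C''$-rough CAT(0) for every $C''>C$. Conversely, if $X$ is weakly $C_0$-rough CAT(0) for some $C_0>0$, then for every $n\ge 3$ it satisfies the $(n-2)C_0$-rough $n$-point condition. -/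

import Mathlib

open Set

/-- The plane with its Euclidean metric. -/
abbrev Plane : Type := EuclideanSpace ℝ (Fin 2)

/-- An `h`-short segment from `x` to `y` (for `h ≥ 0`): a path `γ : [0, L] → X`, `L ≥ 0`, from `x`
to `y` with `len γ ≥ d(x, y) ≥ len γ - h`. Only the values of `toFun` on `[0, L]` matter; the length
of a path is its total variation, and the second inequality is stated as
`len γ ≤ d(x, y) + h` in `[0, ∞]`, so that in particular `len γ` is finite. -/
structure ShortSegment {X : Type*} [MetricSpace X] (h : ℝ) (x y : X) where
  L : ℝ
  L_nonneg : 0 ≤ L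
  toFun : ℝ → X
  continuousOn : ContinuousOn toFun (Icc 0 L)
  source : toFun 0 = x
  target : toFun L = y
  edist_le_length : edist x y ≤ eVariationOn toFun (Icc 0 L)
  length_le : eVariationOn toFun (Icc 0 L) ≤ edist x y + ENNReal.ofReal h

/-- A length space: any two points are joined by an `h`-short segment, for every `h > 0`. -/
def IsLengthSpace (X : Type*) [MetricSpace X] : Prop :=
  ∀ x y : X, ∀ h : ℝ, 0 < h → Nonempty (ShortSegment h x y)

/-- `q` is a comparison point on the Euclidean segment `[a, b]` for the point `u = γ t` of the short
segment `γ` from `x` to `y`: it lies on `[a, b]`, with `|a - q| ≤ len [x, u]` and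
`|q - b| ≤ len [u, y]`, where `[x, u]` and `[u, y]` are the subpaths `γ|[0, t]` and `γ|[t, L]`. -/
def ShortSegment.IsComparisonPoint {X : Type*} [MetricSpace X] {h : ℝ} {x y : X}
    (γ : ShortSegment h x y) (t : ℝ) (a b q : Plane) : Prop :=
  q ∈ segment ℝ a b ∧
  edist a q ≤ eVariationOn γ.toFun (Icc 0 t) ∧
  edist q b ≤ eVariationOn γ.toFun (Icc t γ.L)

/-- The `C`-rough CAT(0) condition for a given function `H : X × X × X → (0, ∞)`.
The vertices of the triangle are `p 0, p 1, p 2`; its sides are `H (p 0) (p 1) (p 2)`-short segments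
`σ i` from `p i` to `p (i + 1)`, with `i + 1` taken modulo `3`. The points `u = σ i s` and
`v = σ j t` lie on different sides, and `pbar 0, pbar 1, pbar 2` are the vertices of a comparison
triangle, with comparison points `ubar` and `vbar` on the corresponding sides. -/
def IsRoughCAT0With (X : Type*) [MetricSpace X] (C : ℝ) (H : X → X → X → ℝ) : Prop :=
  0 < C ∧ IsLengthSpace X ∧ (∀ x y z : X, 0 < H x y z) ∧
  ∀ (p : Fin 3 → X)
    (σ : ∀ i : Fin 3, ShortSegment (H (p 0) (p 1) (p 2)) (p i) (p (i + 1)))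
    (pbar : Fin 3 → Plane), (∀ i j, dist (pbar i) (pbar j) = dist (p i) (p j)) →
  ∀ i j : Fin 3, i ≠ j →
  ∀ s ∈ Icc 0 (σ i).L, ∀ t ∈ Icc 0 (σ j).L,
  ∀ ubar vbar : Plane,
    (σ i).IsComparisonPoint s (pbar i) (pbar (i + 1)) ubar →
    (σ j).IsComparisonPoint t (pbar j) (pbar (j + 1)) vbar →
    dist ((σ i).toFun s) ((σ j).toFun t) ≤ dist ubar vbar + C

/-- The weaker variant of `C`-rough CAT(0): some function `H : X × X × X → (0, ∞)` will do. -/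
def IsRoughCAT0Star (X : Type*) [MetricSpace X] (C : ℝ) : Prop :=
  ∃ H : X → X → X → ℝ, IsRoughCAT0With X C H

/-- `C`-rough CAT(0): the function is `H(x, y, z) = 1 / (1 ∨ d(x, y) ∨ d(x, z) ∨ d(y, z))`. -/
def IsRoughCAT0 (X : Type*) [MetricSpace X] (C : ℝ) : Prop :=
  IsRoughCAT0With X C fun x y z => 1 / (1 ⊔ dist x y ⊔ dist x z ⊔ dist y z)

/-- `(xbar 1, …, xbar n)` is a `C`-rough subembedding of `(x 1, …, x n)` into the plane, with the
convention `x 0 = x n`, `xbar 0 = xbar n`. Only the indices `0, …, n` matter. -/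
structure IsRoughSubembedding {X : Type*} [MetricSpace X] (C : ℝ) (n : ℕ)
    (x : ℕ → X) (xbar : ℕ → Plane) : Prop where
  closed : x 0 = x n
  closed_bar : xbar 0 = xbar n
  dist_side : ∀ i, 1 ≤ i → i ≤ n → dist (x i) (x (i - 1)) = dist (xbar i) (xbar (i - 1))
  dist_first : ∀ i, 2 ≤ i → i ≤ n → dist (x 1) (x i) ≤ dist (xbar 1) (xbar i)
  dist_rough : ∀ i j, 2 ≤ i → i ≤ n → 2 ≤ j → j ≤ n →
    dist (x i) (x j) ≤ dist (xbar i) (xbar j) + C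

/-- The `C`-rough `n`-point condition (for `n ≥ 3`, `C ≥ 0`): every `n`-tuple `(x 1, …, x n)` in `X`,
extended by `x 0 = x n`, has a `C`-rough subembedding into the plane. -/
def RoughNPointCondition (X : Type*) [MetricSpace X] (n : ℕ) (C : ℝ) : Prop :=
  ∀ x : ℕ → X, x 0 = x n → ∃ xbar : ℕ → Plane, IsRoughSubembedding C n x xbar

/-! From rough CAT(0) to `n` points: cut the polygon into a fan of triangles with apex `x 1`.
Choosing a point on a short segment from the apex to each other vertex and applying the rough
comparison once per triangle bounds `d(x i, x j)` by the length of any path through the Euclidean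
comparison triangles, plus one error per triangle. `FanData` keeps only this, and
`FanData.hasPlanarFan` is then a statement about plane polygons.

Laying the comparison triangles side by side does not suffice: where the outer chain is reflex, the
chord between two vertices may be shorter than every path through the triangles. So the spokes are
lengthened as little as possible, with edges fixed, until the chain is convex. With `ρ` the spoke
length and `s` the arclength, convexity of the chain is concavity of `ρ² - s²`, and
`exists_concave_envelope` gives the least solution. Minimality makes the chain straight at every
inner vertex whose spoke has grown, and this is what `exists_path_le_chord` needs to find a path
through the old triangles no longer than the new chord.

The new triangles are glued in the Euclidean cone over the line, since their total angle may be
large. If it is at most `π`, they lie in the plane. Otherwise the geodesic from the first to the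
last vertex runs through the apex. The cone is CAT(0), so the vertices seen from the first of them
form a fan with error `0` and one node fewer. Induction places that fan in the plane, and the old
apex goes on the segment from the first to the last vertex (`exists_planar_of_pi_le`). Degenerate
triangles are reached by a limit.

From `n ≥ 5` points to rough CAT(0): for `u`, `v` on the sides `[x, y]`, `[x, z]`, subembed the
pentagon `x u y z v`. Its paths through `u` and `v` are nearly straight, so `u` and `v` are near
points of the sides of a Euclidean triangle, whose two sides at `x` exceed those of the comparison
triangle by at most `h`. Both discrepancies are controlled by `K h`, where `K` bounds the sides. -/

/-! ### Least concave envelopes along a chain -/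

open Filter Topology in
/-- The least family `ρ ≥ d` on the nodes `0, …, m - 1` for which `ρ² - s²` is concave, where `s` is
arclength along a chain with edge lengths `ℓ`. Away from the nodes with `ρ = d` it is affine. -/
theorem exists_concave_envelope (m : ℕ) (d ℓ : ℕ → ℝ) (hd : ∀ k, 0 < d k) (hℓ : ∀ k, 0 < ℓ k)
    (h₁ : ∀ k, d (k + 1) < d k + ℓ k) (h₂ : ∀ k, d k < d (k + 1) + ℓ k) :
    ∃ ρ : ℕ → ℝ, (∀ k < m, d k ≤ ρ k) ∧ (∀ k, k + 1 = m ∨ k = 0 → k < m → ρ k = d k) ∧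
      (∀ k, k + 1 < m → ρ (k + 1) < ρ k + ℓ k ∧ ρ k < ρ (k + 1) + ℓ k) ∧
      ∀ k, k + 2 < m →
        ℓ (k + 1) * ρ k ^ 2 + ℓ k * ρ (k + 2) ^ 2
          ≤ (ℓ k + ℓ (k + 1)) * (ρ (k + 1) ^ 2 + ℓ k * ℓ (k + 1)) ∧
        (ρ (k + 1) = d (k + 1) ∨
          ℓ (k + 1) * ρ k ^ 2 + ℓ k * ρ (k + 2) ^ 2
            = (ℓ k + ℓ (k + 1)) * (ρ (k + 1) ^ 2 + ℓ k * ℓ (k + 1))) := by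
  obtain ⟨s, hs⟩ : ∃ s : ℕ → ℝ, ∀ k, s (k + 1) = s k + ℓ k :=
    ⟨fun k => ∑ j ∈ Finset.range k, ℓ j, fun k => Finset.sum_range_succ _ _⟩
  have hsm : StrictMono s := strictMono_nat_of_lt_succ fun k => by rw [hs]; linarith [hℓ k]
  have hup : ∀ i k, i < k → d k < d i + (s k - s i) ∧ d i < d k + (s k - s i) := by
    intro i k hik
    induction k, hik using Nat.le_induction with
    | base => rw [hs]; constructor <;> linarith [h₁ i, h₂ i]
    | succ k _ ih => rw [hs]; constructor <;> linarith [h₁ k, h₂ k, ih.1, ih.2]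
  have hpair : ∀ i k, i ≠ k → d k < d i + |s k - s i| := by
    intro i k hik
    rcases lt_or_gt_of_ne hik with h | h
    · rw [abs_of_pos (by linarith [hsm h])]; exact (hup i k h).1
    · rw [abs_of_neg (by linarith [hsm h])]; linarith [(hup k i h).2]
  -- For `r = ρ²` the concavity of `r - s²` is a linear inequality at each inner node, and it passes
  -- to pointwise infima. So the family has a least element.
  set F : Set (ℕ → ℝ) := {r | (∀ k < m, d k ^ 2 ≤ r k) ∧ ∀ k, k + 2 < m →
    ℓ (k + 1) * r k + ℓ k * r (k + 2) ≤ (ℓ k + ℓ (k + 1)) * (r (k + 1) + ℓ k * ℓ (k + 1))} with hF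
  have hne : F.Nonempty := by
    refine ⟨fun k => (d 0 + (s k - s 0)) ^ 2, fun k _ => ?_, fun k _ => le_of_eq ?_⟩
    · rcases Nat.eq_zero_or_pos k with rfl | hk
      · simp
      · exact pow_le_pow_left₀ (hd k).le (hup 0 k hk).1.le 2
    · simp only [hs]; ring
  set r : ℕ → ℝ := fun k => sInf ((fun f : ℕ → ℝ => f k) '' F) with hr
  have hbdd : ∀ k < m, BddBelow ((fun f : ℕ → ℝ => f k) '' F) := fun k hk =>
    ⟨d k ^ 2, by rintro _ ⟨f, hf, rfl⟩; exact hf.1 k hk⟩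
  have hmin : ∀ f ∈ F, ∀ k < m, r k ≤ f k := fun f hf k hk =>
    csInf_le (hbdd k hk) ⟨f, hf, rfl⟩
  have hrF : r ∈ F := by
    refine ⟨fun k hk => le_csInf (hne.image _) ?_, fun k hk => ?_⟩
    · rintro _ ⟨f, hf, rfl⟩; exact hf.1 k hk
    · have hp := hℓ k
      have hq := hℓ (k + 1)
      have : (ℓ (k + 1) * r k + ℓ k * r (k + 2)) / (ℓ k + ℓ (k + 1)) - ℓ k * ℓ (k + 1)
          ≤ r (k + 1) := by
        refine le_csInf (hne.image _) ?_
        rintro _ ⟨f, hf, rfl⟩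
        rw [sub_le_iff_le_add, div_le_iff₀ (by positivity)]
        have h1 := mul_le_mul_of_nonneg_left (hmin f hf k (by omega)) hq.le
        have h2 := mul_le_mul_of_nonneg_left (hmin f hf (k + 2) (by omega)) hp.le
        have h3 := hf.2 k hk
        simp only
        linarith
      rw [sub_le_iff_le_add, div_le_iff₀ (by positivity)] at this
      linarith
  -- Lowering one value only relaxes the constraints centred at the other nodes. Hence only `d k ^
  -- 2` or the constraint centred at `k` itself can stop it, and at the two ends there is no such
  -- constraint.
  have hlower : ∀ k < m, ∀ v, d k ^ 2 ≤ v → v ≤ r k →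
      (∀ j, j + 1 = k → k + 1 < m →
        ℓ (j + 1) * r j + ℓ j * r (j + 2) ≤ (ℓ j + ℓ (j + 1)) * (v + ℓ j * ℓ (j + 1))) →
      r k ≤ v := by
    intro k hk v hdv hv hc
    have hle : ∀ j, Function.update r k v j ≤ r j := by
      intro j
      by_cases hj : j = k
      · subst hj; simpa using hv
      · simp [hj]
    have hmem : Function.update r k v ∈ F := by
      refine ⟨fun j hj => ?_, fun j hj => ?_⟩
      · by_cases hjk : j = k
        · subst hjk; simpa using hdv
        · simpa [hjk] using hrF.1 j hj
      · have h1 := mul_le_mul_of_nonneg_left (hle j) (hℓ (j + 1)).le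
        have h2 := mul_le_mul_of_nonneg_left (hle (j + 2)) (hℓ j).le
        by_cases hjk : j + 1 = k
        · have := hc j hjk (by omega)
          subst hjk
          simp only [Function.update_self]
          linarith
        · rw [Function.update_of_ne hjk]
          linarith [hrF.2 j hj]
    simpa using hmin _ hmem k hk
  have hr0 : ∀ k < m, 0 < r k := fun k hk => lt_of_lt_of_le (pow_pos (hd k) 2) (hrF.1 k hk)
  have hsq : ∀ k < m, √(r k) ^ 2 = r k := fun k hk => Real.sq_sqrt (hr0 k hk).le
  have hρd : ∀ k < m, d k ≤ √(r k) := fun k hk => Real.le_sqrt_of_sq_le (hrF.1 k hk)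
  have hcontact : ∀ k < m, r k ≤ d k ^ 2 → √(r k) = d k := fun k hk h =>
    le_antisymm ((Real.sqrt_le_left (hd k).le).2 h) (hρd k hk)
  -- The strict triangle inequalities, finitely many in number, leave room for a factor `c < 1`,
  -- which later makes the triangles with sides `ρ` strict as well.
  obtain ⟨c, ⟨hc, hc0⟩, hc1⟩ : ∃ c : ℝ, ((∀ i ∈ Finset.range m, ∀ k ∈ Finset.range m, i ≠ k →
      d k ^ 2 < d i ^ 2 + 2 * c * d i * |s k - s i| + |s k - s i| ^ 2) ∧ 0 < c) ∧ c < 1 := by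
    have h1 : ∀ᶠ c : ℝ in 𝓝 1, ∀ i ∈ Finset.range m, ∀ k ∈ Finset.range m, i ≠ k →
        d k ^ 2 < d i ^ 2 + 2 * c * d i * |s k - s i| + |s k - s i| ^ 2 := by
      rw [Filter.eventually_all_finset]
      intro i _
      rw [Filter.eventually_all_finset]
      intro k _
      rw [Filter.eventually_imp_distrib_left]
      intro hik
      refine (Continuous.tendsto (f := fun c : ℝ =>
        d i ^ 2 + 2 * c * d i * |s k - s i| + |s k - s i| ^ 2) (by fun_prop) 1).eventually
        (lt_mem_nhds ?_)
      have := pow_lt_pow_left₀ (hpair i k hik) (hd k).le two_ne_zero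
      nlinarith
    have h2 : ∀ᶠ c : ℝ in 𝓝 1, 0 < c := lt_mem_nhds one_pos
    have h3 : ∀ᶠ c : ℝ in 𝓝[<] 1, c < 1 := eventually_mem_nhdsWithin
    exact (((h1.and h2).filter_mono nhdsWithin_le_nhds).and h3).exists
  -- The competitor is `min r Q`. On either side of `i`, `Q - s²` is affine. Its convex kink at `i`
  -- is harmless because `Q i = r i`, so that the concavity of `r` takes over there.
  have hslope : ∀ i < m, ∀ k < m, i ≠ k →
      r k ≤ r i + 2 * c * √(r i) * |s k - s i| + |s k - s i| ^ 2 := by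
    intro i hi k hk hik
    set Q : ℕ → ℝ := fun j => r i + 2 * c * √(r i) * |s j - s i| + |s j - s i| ^ 2 with hQ
    have hmem : (fun j => min (r j) (Q j)) ∈ F := by
      refine ⟨fun j hj => le_min (hrF.1 j hj) ?_, fun j hj => ?_⟩
      · by_cases hji : i = j
        · subst hji; simpa [hQ] using hrF.1 i hj
        · have h1 := hc i (by simpa using hi) j (by simpa using hj) hji
          have h2 := hrF.1 i hi
          have h3 : c * |s j - s i| * d i ≤ c * |s j - s i| * √(r i) :=
            mul_le_mul_of_nonneg_left (hρd i hi) (by positivity)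
          simp only [hQ]
          linarith
      · have a1 := mul_le_mul_of_nonneg_left (min_le_left (r j) (Q j)) (hℓ (j + 1)).le
        have a2 := mul_le_mul_of_nonneg_left (min_le_left (r (j + 2)) (Q (j + 2))) (hℓ j).le
        have b1 := mul_le_mul_of_nonneg_left (min_le_right (r j) (Q j)) (hℓ (j + 1)).le
        have b2 := mul_le_mul_of_nonneg_left (min_le_right (r (j + 2)) (Q (j + 2))) (hℓ j).le
        have a3 := hrF.2 j hj
        rcases le_total (r (j + 1)) (Q (j + 1)) with h | h
        · simp only [min_eq_left h]; linarith
        · by_cases hji : j + 1 = i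
          · have : Q (j + 1) = r (j + 1) := by simp [hQ, hji]
            simp only [min_eq_right h]
            rw [this]; linarith
          · simp only [min_eq_right h]
            have : ℓ (j + 1) * Q j + ℓ j * Q (j + 2)
                = (ℓ j + ℓ (j + 1)) * (Q (j + 1) + ℓ j * ℓ (j + 1)) := by
              have e1 := hs j
              have e2 := hs (j + 1)
              rcases lt_or_gt_of_ne hji with h' | h'
              · have g1 := hsm.monotone (show j ≤ i by omega)
                have g2 := hsm.monotone (show j + 1 ≤ i by omega)
                have g3 := hsm.monotone (show j + 2 ≤ i by omega)
                simp only [hQ]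
                rw [abs_of_nonpos (by linarith), abs_of_nonpos (by linarith),
                  abs_of_nonpos (by linarith), show j + 2 = j + 1 + 1 from rfl, e2, e1]
                ring
              · have g1 := hsm.monotone (show i ≤ j by omega)
                have g2 := hsm.monotone (show i ≤ j + 1 by omega)
                have g3 := hsm.monotone (show i ≤ j + 2 by omega)
                simp only [hQ]
                rw [abs_of_nonneg (by linarith), abs_of_nonneg (by linarith),
                  abs_of_nonneg (by linarith), show j + 2 = j + 1 + 1 from rfl, e2, e1]
                ring
            linarith
    exact (hmin _ hmem k hk).trans (min_le_right _ _)
  refine ⟨fun k => √(r k), hρd, ?_, ?_, ?_⟩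
  · intro k hk hkm
    refine hcontact k hkm (hlower k hkm _ le_rfl (hrF.1 k hkm) ?_)
    intro j hj1 hj2
    omega
  · intro k hk
    have key : ∀ i < m, ∀ k < m, i ≠ k → |s k - s i| = ℓ (min i k) →
        √(r k) < √(r i) + ℓ (min i k) := by
      intro i hi k hk hik he
      have h1 := hslope i hi k hk hik
      rw [he] at h1
      have hpos := Real.sqrt_pos.2 (hr0 i hi)
      have hl := hℓ (min i k)
      refine (Real.sqrt_lt' (by positivity)).2 (lt_of_le_of_lt h1 ?_)
      have h2 := hsq i hi
      have : 2 * c * √(r i) * ℓ (min i k) < 2 * 1 * √(r i) * ℓ (min i k) := by gcongr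
      nlinarith
    constructor
    · have := key k (by omega) (k + 1) hk (by omega)
        (by rw [hs, Nat.min_eq_left (by omega), add_sub_cancel_left, abs_of_pos (hℓ k)])
      rwa [Nat.min_eq_left (by omega)] at this
    · have := key (k + 1) hk k (by omega) (by omega)
        (by rw [hs, Nat.min_eq_right (by omega), sub_add_cancel_left, abs_neg, abs_of_pos (hℓ k)])
      rwa [Nat.min_eq_right (by omega)] at this
  · intro k hk
    simp only
    rw [hsq k (by omega), hsq (k + 1) (by omega), hsq (k + 2) hk]
    refine ⟨hrF.2 k hk, ?_⟩
    by_contra! hcon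
    have hp := hℓ k
    have hq := hℓ (k + 1)
    have hlt := lt_of_le_of_ne (hrF.2 k hk) hcon.2
    set v := (ℓ (k + 1) * r k + ℓ k * r (k + 2)) / (ℓ k + ℓ (k + 1)) - ℓ k * ℓ (k + 1) with hv
    have hvr : v < r (k + 1) := by
      rw [hv, sub_lt_iff_lt_add, div_lt_iff₀ (by positivity)]; linarith
    have hdr : d (k + 1) ^ 2 < r (k + 1) := lt_of_not_ge fun h =>
      hcon.1 (hcontact (k + 1) (by omega) h)
    have := hlower (k + 1) (by omega) (max (d (k + 1) ^ 2) v) (le_max_left _ _)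
      (max_le hdr.le hvr.le) (by
        intro j hj _
        obtain rfl : j = k := by omega
        have h1 : v ≤ max (d (j + 1) ^ 2) v := le_max_right _ _
        have h2 := mul_le_mul_of_nonneg_left h1 (show 0 ≤ ℓ j + ℓ (j + 1) by positivity)
        have h3 : (ℓ j + ℓ (j + 1)) * v = ℓ (j + 1) * r j + ℓ j * r (j + 2)
            - (ℓ j + ℓ (j + 1)) * (ℓ j * ℓ (j + 1)) := by
          rw [hv]; field_simp
        linarith)
    exact absurd this (not_le.2 (max_lt hdr hvr))

/-! ### Cevians and chords of convex chains -/

/-- Squared distance between the points at fractions `l`, `m` of the sides of squared lengths `a`,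
`b` issuing from a vertex of a Euclidean triangle whose third side has squared length `c`. -/
def cevianSq (l m a b c : ℝ) : ℝ := l * (l - m) * a + m * (m - l) * b + l * m * c

theorem cevianSq_nonneg {l m a b c : ℝ} (hl : 0 ≤ l) (hm : 0 ≤ m) (h₁ : a ≤ b + c)
    (h₂ : b ≤ a + c) : 0 ≤ cevianSq l m (a ^ 2) (b ^ 2) (c ^ 2) := by
  have h : cevianSq l m (a ^ 2) (b ^ 2) (c ^ 2)
      = (l * a - m * b) ^ 2 + l * m * ((c + b - a) * (c + a - b)) := by
    unfold cevianSq; ring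
  rw [h]
  have := mul_nonneg (mul_nonneg hl hm)
    (mul_nonneg (show 0 ≤ c + b - a by linarith) (show 0 ≤ c + a - b by linarith))
  positivity

theorem sqrt_le_half_div_add {e w : ℝ} (he : 0 ≤ e) (hw : 0 < w) : √e ≤ (e / w + w) / 2 := by
  rw [le_div_iff₀ two_pos, div_add' _ _ _ hw.ne', le_div_iff₀ hw]
  nlinarith [Real.sq_sqrt he, sq_nonneg (√e - w)]

theorem le_of_forall_le_succ {f : ℕ → ℝ} {a b : ℕ} (hab : a ≤ b)
    (h : ∀ k, a ≤ k → k < b → f k ≤ f (k + 1)) : f a ≤ f b := by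
  induction b, hab using Nat.le_induction with
  | base => exact le_rfl
  | succ b hb ih =>
    exact (ih fun k h1 h2 => h k h1 (by omega)).trans (h b hb (by omega))

/-- A convex chain of points in the upper half plane, seen from the origin, has its end points at the
same height. If the distances from the origin to the vertices that are strictly convex are kept and
the others are decreased, edge lengths fixed, then the chord becomes a path no longer than before. -/
theorem exists_path_le_chord {i j : ℕ} (hij : i < j) (X Y D : ℕ → ℝ)
    (hY : ∀ k, i ≤ k → k ≤ j → 0 < Y k)
    (hA : ∀ k, i ≤ k → k < j → 0 < X k * Y (k + 1) - X (k + 1) * Y k)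
    (hD : ∀ k, i ≤ k → k ≤ j → D k ≤ X k ^ 2 + Y k ^ 2)
    (hE : ∀ k l m, i ≤ k → k < j → 0 ≤ l → 0 ≤ m →
      0 ≤ cevianSq l m (D k) (D (k + 1)) ((X (k + 1) - X k) ^ 2 + (Y (k + 1) - Y k) ^ 2))
    (hturn : ∀ k, i ≤ k → k + 2 ≤ j → 0 ≤ (X (k + 1) - X k) * (Y (k + 2) - Y (k + 1))
      - (Y (k + 1) - Y k) * (X (k + 2) - X (k + 1)))
    (hcomp : ∀ k, i ≤ k → k + 2 ≤ j → D (k + 1) = X (k + 1) ^ 2 + Y (k + 1) ^ 2 ∨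
      (X (k + 1) - X k) * (Y (k + 2) - Y (k + 1))
        - (Y (k + 1) - Y k) * (X (k + 2) - X (k + 1)) = 0)
    (hend : Y i = Y j) :
    ∃ l : ℕ → ℝ, (∀ k, i ≤ k → k ≤ j → 0 ≤ l k ∧ l k ≤ 1) ∧ l i = 1 ∧ l j = 1 ∧
      ∑ k ∈ Finset.Ico i j, √(cevianSq (l k) (l (k + 1)) (D k) (D (k + 1))
        ((X (k + 1) - X k) ^ 2 + (Y (k + 1) - Y k) ^ 2)) ≤ X i - X j := by
  -- The line through edge `k` is the set of `p` with `⟨n, p⟩ = 1` for a vector `n` whose first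
  -- coordinate is `κ k`. It decreases at left turns and is constant at straight vertices.
  set A : ℕ → ℝ := fun k => X k * Y (k + 1) - X (k + 1) * Y k with hAdef
  set κ : ℕ → ℝ := fun k => (Y (k + 1) - Y k) / A k with hκ
  have hκY : ∀ k, i ≤ k → k < j → Y (k + 1) - Y k = κ k * A k := fun k h1 h2 =>
    (div_mul_cancel₀ _ (hA k h1 h2).ne').symm
  have hid : ∀ k, (Y (k + 1) - Y k) * A (k + 1) - (Y (k + 2) - Y (k + 1)) * A k
      = Y (k + 1) * ((X (k + 1) - X k) * (Y (k + 2) - Y (k + 1))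
        - (Y (k + 1) - Y k) * (X (k + 2) - X (k + 1))) := by
    intro k; simp only [hAdef]; ring
  have hanti : ∀ k, i ≤ k → k + 2 ≤ j → κ (k + 1) ≤ κ k := by
    intro k h1 h2
    have := mul_nonneg (hY (k + 1) (by omega) (by omega)).le (hturn k h1 h2)
    rw [← hid] at this
    exact (div_le_div_iff₀ (hA (k + 1) (by omega) (by omega)) (hA k h1 (by omega))).2
      (by linarith)
  have hflat : ∀ k, i ≤ k → k + 2 ≤ j → D (k + 1) = X (k + 1) ^ 2 + Y (k + 1) ^ 2 ∨
      κ (k + 1) = κ k := by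
    intro k h1 h2
    refine (hcomp k h1 h2).imp id fun h => ?_
    have h3 := hid k
    rw [h, mul_zero] at h3
    exact (div_eq_div_iff (hA (k + 1) (by omega) (by omega)).ne' (hA k h1 (by omega)).ne').2
      (by linarith)
  have hanti' : ∀ a b, i ≤ a → a ≤ b → b < j → κ b ≤ κ a := by
    intro a b ha hab hb
    have := le_of_forall_le_succ (f := fun k => - κ k) hab
      fun k h1 h2 => neg_le_neg (hanti k (by omega) (by omega))
    simpa using this
  have hup : ∀ k, i ≤ k → k < j → 0 ≤ κ k → Y i ≤ Y (k + 1) := by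
    intro k h1 h2 h3
    refine le_of_forall_le_succ (by omega) fun l hl1 hl2 => ?_
    have := hκY l hl1 (by omega)
    have := mul_nonneg (h3.trans (hanti' l k hl1 (by omega) h2)) (hA l hl1 (by omega)).le
    linarith
  have hdown : ∀ k, i ≤ k → k < j → κ k ≤ 0 → Y j ≤ Y k := by
    intro k h1 h2 h3
    have := le_of_forall_le_succ (f := fun k => - Y k) h2.le fun l hl1 hl2 => by
      have := hκY l (by omega) hl2
      have := mul_nonneg (neg_nonneg.2 ((hanti' k l h1 hl1 hl2).trans h3))
        (hA l (by omega) hl2).le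
      linarith
    simpa using this
  have hκi : 0 ≤ κ i := by
    by_contra! h
    have h1 := hκY i le_rfl hij
    have h2 := mul_pos (neg_pos.2 h) (hA i le_rfl hij)
    rcases Nat.lt_or_ge (i + 1) j with h3 | h3
    · have := hdown (i + 1) (by omega) h3 ((hanti' i (i + 1) le_rfl (by omega) h3).trans h.le)
      simp only [hAdef] at h1 h2
      linarith
    · obtain rfl : j = i + 1 := by omega
      simp only [hAdef] at h1 h2
      linarith
  have hκj : ∀ k, k + 1 = j → κ k ≤ 0 := by
    intro k hk
    subst hk
    by_contra! h
    have h1 := hκY k (by omega) (by omega)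
    have h2 := mul_pos h (hA k (by omega) (by omega))
    have h3 : Y i ≤ Y k := by
      rcases Nat.lt_or_ge i k with h4 | h4
      · obtain ⟨a, rfl⟩ : ∃ a, k = a + 1 := ⟨k - 1, by omega⟩
        exact hup a (by omega) (by omega)
          (h.le.trans (hanti' a (a + 1) (by omega) (by omega) (by omega)))
      · rw [show k = i by omega]
    simp only [hAdef] at h1 h2
    linarith
  have hYi : ∀ k, i ≤ k → k ≤ j → Y i ≤ Y k := by
    intro k h1 h2
    rcases eq_or_lt_of_le h2 with rfl | h2
    · exact hend.le
    rcases eq_or_lt_of_le h1 with rfl | h1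
    · exact le_rfl
    obtain ⟨a, rfl⟩ : ∃ a, k = a + 1 := ⟨k - 1, by omega⟩
    rcases le_total 0 (κ (a + 1)) with h | h
    · exact hup a (by omega) (by omega) (h.trans (hanti' a (a + 1) (by omega) (by omega) h2))
    · exact hend.le.trans (hdown _ h1.le h2 h)
  have hh := hY i le_rfl hij.le
  -- The chord has height `Y i`, so it meets the ray to vertex `k` at this fraction.
  set l : ℕ → ℝ := fun k => Y i / Y k with hl
  have hl01 : ∀ k, i ≤ k → k ≤ j → 0 ≤ l k ∧ l k ≤ 1 := fun k h1 h2 =>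
    ⟨div_nonneg hh.le (hY k h1 h2).le, (div_le_one (hY k h1 h2)).2 (hYi k h1 h2)⟩
  refine ⟨l, hl01, div_self hh.ne', by simp only [hl, ← hend]; exact div_self hh.ne', ?_⟩
  set b : ℕ → ℝ := fun k => l k * (D k - (X k ^ 2 + Y k ^ 2)) with hb
  have hb0 : ∀ k, i ≤ k → k ≤ j → b k ≤ 0 := fun k h1 h2 =>
    mul_nonpos_of_nonneg_of_nonpos (hl01 k h1 h2).1 (by linarith [hD k h1 h2])
  -- Let `w` be the piece of the chord between two rays. Passing to the squared spokes `D` changes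
  -- `w²` into `w (w + κ k (b k - b (k + 1)))`; the arithmetic-geometric mean inequality removes the
  -- root.
  have hterm : ∀ k ∈ Finset.Ico i j, √(cevianSq (l k) (l (k + 1)) (D k) (D (k + 1))
        ((X (k + 1) - X k) ^ 2 + (Y (k + 1) - Y k) ^ 2))
      ≤ (l k * X k - l (k + 1) * X (k + 1)) + κ k * (b k - b (k + 1)) / 2 := by
    intro k hk
    obtain ⟨h1, h2⟩ := Finset.mem_Ico.1 hk
    have y1 := hY k h1 h2.le
    have y2 := hY (k + 1) (by omega) (by omega)
    have hAk := hA k h1 h2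
    have hw : l k * X k - l (k + 1) * X (k + 1) = Y i * A k / (Y k * Y (k + 1)) := by
      simp only [hl, hAdef]; field_simp
    have hw0 : 0 < l k * X k - l (k + 1) * X (k + 1) := by rw [hw]; positivity
    refine (sqrt_le_half_div_add (hE k _ _ h1 h2 (hl01 k h1 h2.le).1
      (hl01 (k + 1) (by omega) (by omega)).1) hw0).trans (le_of_eq ?_)
    have hlk : l k - l (k + 1) = κ k * (l k * X k - l (k + 1) * X (k + 1)) := by
      rw [hw]
      simp only [hκ, hl]
      have : A k ≠ 0 := hAk.ne'
      field_simp
    have hly : l k * Y k = l (k + 1) * Y (k + 1) := by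
      simp only [hl]; field_simp
    set w := l k * X k - l (k + 1) * X (k + 1) with hwdef
    have : cevianSq (l k) (l (k + 1)) (D k) (D (k + 1))
        ((X (k + 1) - X k) ^ 2 + (Y (k + 1) - Y k) ^ 2)
        = w * (w + κ k * (b k - b (k + 1))) := by
      have e1 : cevianSq (l k) (l (k + 1)) (D k) (D (k + 1))
          ((X (k + 1) - X k) ^ 2 + (Y (k + 1) - Y k) ^ 2)
          = w ^ 2 + (l k * Y k - l (k + 1) * Y (k + 1)) ^ 2
            + (l k - l (k + 1)) * (b k - b (k + 1)) := by
        simp only [cevianSq, hwdef, hb]; ring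
      rw [e1, hlk, hly]; ring
    rw [this, mul_div_cancel_left₀ _ hw0.ne']
    ring
  refine (Finset.sum_le_sum hterm).trans ?_
  rw [Finset.sum_add_distrib]
  have htel : ∀ J, i ≤ J → ∑ k ∈ Finset.Ico i J, (l k * X k - l (k + 1) * X (k + 1))
      = l i * X i - l J * X J := by
    intro J hJ
    induction J, hJ using Nat.le_induction with
    | base => simp
    | succ J hJ ih => rw [Finset.sum_Ico_succ_top hJ, ih]; ring
  -- Summation by parts. Each inner term has a factor `b` or a jump of `κ`, and `hflat` makes one of
  -- the two vanish. The boundary terms have the right sign.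
  have habel : ∀ J, i ≤ J → J + 1 ≤ j →
      ∑ k ∈ Finset.Ico i (J + 1), κ k * (b k - b (k + 1)) / 2
        = (κ i * b i - κ J * b (J + 1)) / 2 := by
    intro J hJ
    induction J, hJ using Nat.le_induction with
    | base => intro; simp; ring
    | succ J hJ ih =>
      intro h
      rw [Finset.sum_Ico_succ_top (by omega), ih (by omega)]
      rcases hflat J hJ h with h0 | h0
      · have : b (J + 1) = 0 := by simp [hb, h0]
        rw [this]; ring
      · rw [h0]; ring
  obtain ⟨J, rfl⟩ : ∃ J, j = J + 1 := ⟨j - 1, by omega⟩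
  rw [htel _ hij.le, habel J (by omega) le_rfl]
  have e1 : l i = 1 := div_self hh.ne'
  have e2 : l (J + 1) = 1 := by simp only [hl, ← hend]; exact div_self hh.ne'
  rw [e1, e2, one_mul, one_mul]
  have g1 := mul_nonneg hκi (neg_nonneg.2 (hb0 i le_rfl hij.le))
  have g2 := mul_nonneg (neg_nonneg.2 (hκj J rfl)) (neg_nonneg.2 (hb0 (J + 1) hij.le le_rfl))
  linarith

/-- At a vertex of a fan the chain turns left as soon as `ρ² - s²` is concave there, and it is
straight if `ρ² - s²` is affine. The vertex is `P`, the edges before and after it are `u`, `v`. -/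
theorem turn_of_concave {p₁ p₂ u₁ u₂ v₁ v₂ a b : ℝ} (ha : 0 < a) (hb : 0 < b)
    (hu : u₁ ^ 2 + u₂ ^ 2 = a ^ 2) (hv : v₁ ^ 2 + v₂ ^ 2 = b ^ 2)
    (h₁ : 0 < p₁ * u₂ - p₂ * u₁) (h₂ : 0 < p₁ * v₂ - p₂ * v₁) :
    (a * (p₁ * v₁ + p₂ * v₂) ≤ b * (p₁ * u₁ + p₂ * u₂) → 0 ≤ u₁ * v₂ - u₂ * v₁) ∧
    (a * (p₁ * v₁ + p₂ * v₂) = b * (p₁ * u₁ + p₂ * u₂) → u₁ * v₂ - u₂ * v₁ = 0) := by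
  -- The vectors `(x, y)` and `(x', y')` have equal length and lie in the upper half plane. Their
  -- determinant is a positive multiple of that of the edges, so its sign follows from comparing `x`
  -- with `x'`.
  set x := b * (p₁ * u₁ + p₂ * u₂) with hx
  set x' := a * (p₁ * v₁ + p₂ * v₂) with hx'
  set y := b * (p₁ * u₂ - p₂ * u₁) with hy
  set y' := a * (p₁ * v₂ - p₂ * v₁) with hy'
  have y0 : 0 < y := by positivity
  have y0' : 0 < y' := by positivity
  have hsum : x ^ 2 + y ^ 2 = x' ^ 2 + y' ^ 2 := by
    have e1 : x ^ 2 + y ^ 2 = b ^ 2 * (p₁ ^ 2 + p₂ ^ 2) * (u₁ ^ 2 + u₂ ^ 2) := by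
      simp only [hx, hy]; ring
    have e2 : x' ^ 2 + y' ^ 2 = a ^ 2 * (p₁ ^ 2 + p₂ ^ 2) * (v₁ ^ 2 + v₂ ^ 2) := by
      simp only [hx', hy']; ring
    rw [e1, e2, hu, hv]; ring
  have hp : 0 < p₁ ^ 2 + p₂ ^ 2 := by
    by_contra! h
    have e1 : p₁ = 0 := by nlinarith [sq_nonneg p₁, sq_nonneg p₂]
    have e2 : p₂ = 0 := by nlinarith [sq_nonneg p₁, sq_nonneg p₂]
    simp [e1, e2] at h₁
  have hdet : x * y' - y * x' = a * b * (p₁ ^ 2 + p₂ ^ 2) * (u₁ * v₂ - u₂ * v₁) := by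
    simp only [hx, hx', hy, hy']; ring
  have hc : 0 < a * b * (p₁ ^ 2 + p₂ ^ 2) := by positivity
  constructor
  · intro h
    refine nonneg_of_mul_nonneg_right ?_ hc
    rw [← hdet]
    rcases le_total x' 0 with h0 | h0
    · rcases le_total 0 x with h1 | h1
      · nlinarith [mul_nonneg h1 y0'.le, mul_nonneg y0.le (neg_nonneg.2 h0)]
      · have : y' ≤ y := by
          refine (sq_le_sq₀ y0'.le y0.le).1 ?_
          nlinarith
        nlinarith
    · have : y ≤ y' := by
        refine (sq_le_sq₀ y0.le y0'.le).1 ?_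
        nlinarith
      nlinarith
  · intro h
    have : y = y' := by
      have : y ^ 2 = y' ^ 2 := by rw [h] at hsum; linarith
      exact (pow_left_inj₀ y0.le y0'.le two_ne_zero).1 this
    rw [h, this] at hdet
    have h0 : a * b * (p₁ ^ 2 + p₂ ^ 2) * (u₁ * v₂ - u₂ * v₁) = 0 := by rw [← hdet]; ring
    exact (mul_eq_zero.1 h0).resolve_left hc.ne'

/-! ### The Euclidean cone over the line -/

/-- A point of the Euclidean cone over the real line, in polar coordinates. -/
structure ConePoint where
  radius : ℝ
  angle : ℝ
  radius_nonneg : 0 ≤ radius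

namespace ConePoint

/-- The cosine of the angle at the apex, angles being truncated at `π`. -/
noncomputable def cosAngle (s t : ℝ) : ℝ := Real.cos (min |s - t| Real.pi)

theorem cosAngle_comm (s t : ℝ) : cosAngle s t = cosAngle t s := by
  unfold cosAngle; rw [abs_sub_comm]

theorem cosAngle_self (s : ℝ) : cosAngle s s = 1 := by
  simp [cosAngle, Real.pi_pos.le]

theorem cosAngle_le_one (s t : ℝ) : cosAngle s t ≤ 1 := Real.cos_le_one _

theorem neg_one_le_cosAngle (s t : ℝ) : -1 ≤ cosAngle s t := Real.neg_one_le_cos _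

theorem cosAngle_of_le {s t : ℝ} (h : |s - t| ≤ Real.pi) : cosAngle s t = Real.cos (s - t) := by
  rw [cosAngle, min_eq_left h, Real.cos_abs]

theorem cosAngle_of_ge {s t : ℝ} (h : Real.pi ≤ |s - t|) : cosAngle s t = -1 := by
  rw [cosAngle, min_eq_right h, Real.cos_pi]

theorem cosAngle_le_cos (s t : ℝ) : cosAngle s t ≤ Real.cos (s - t) := by
  rcases le_total |s - t| Real.pi with h | h
  · rw [cosAngle_of_le h]
  · rw [cosAngle_of_ge h]; exact Real.neg_one_le_cos _

theorem cosAngle_add_nonpos {s t u : ℝ} (h : Real.pi ≤ |s - u| + |u - t|) :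
    cosAngle s u + cosAngle u t ≤ 0 := by
  rcases le_total |s - u| Real.pi with h₁ | h₁
  · rcases le_total |u - t| Real.pi with h₂ | h₂
    · have : Real.cos |u - t| ≤ Real.cos (Real.pi - |s - u|) :=
        Real.cos_le_cos_of_nonneg_of_le_pi (by linarith) h₂ (by linarith)
      rw [Real.cos_pi_sub] at this
      unfold cosAngle
      rw [min_eq_left h₁, min_eq_left h₂]
      linarith
    · linarith [cosAngle_of_ge h₂, cosAngle_le_one s u]
  · linarith [cosAngle_of_ge h₁, cosAngle_le_one u t]

theorem cosAngle_le_neg_cos {s t u : ℝ} (h : Real.pi ≤ |s - u| + |u - t|)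
    (hu : |u - t| ≤ Real.pi) : cosAngle s u ≤ - Real.cos (t - u) := by
  have := cosAngle_add_nonpos h
  rw [cosAngle_of_le hu, ← Real.cos_neg, neg_sub] at this
  linarith

/-- The squared distance in the cone. -/
noncomputable def distSq (p q : ConePoint) : ℝ :=
  p.radius ^ 2 + q.radius ^ 2 - 2 * p.radius * q.radius * cosAngle p.angle q.angle

/-- The point of the plane with the same polar coordinates. -/
noncomputable def toPlane (p : ConePoint) (ω : ℝ) : ℂ :=
  ⟨p.radius * Real.cos (p.angle - ω), p.radius * Real.sin (p.angle - ω)⟩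

theorem norm_toPlane_sub_sq (p q : ConePoint) (ω : ℝ) : ‖p.toPlane ω - q.toPlane ω‖ ^ 2
    = p.radius ^ 2 + q.radius ^ 2
      - 2 * p.radius * q.radius * Real.cos (p.angle - q.angle) := by
  rw [Complex.sq_norm, Complex.normSq_apply]
  have h : Real.cos (p.angle - q.angle) = Real.cos ((p.angle - ω) - (q.angle - ω)) := by
    congr 1; ring
  rw [h, Real.cos_sub]
  simp only [toPlane, Complex.sub_re, Complex.sub_im]
  have h₁ := Real.sin_sq_add_cos_sq (p.angle - ω)
  have h₂ := Real.sin_sq_add_cos_sq (q.angle - ω)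
  linear_combination p.radius ^ 2 * h₁ + q.radius ^ 2 * h₂

/-- Wrapping the cone around the plane shortens distances, and preserves them for angles up to `π`.
This gives the triangle inequality when the outer points span an angle at most `π`. -/
theorem norm_sq_le_distSq (p q : ConePoint) (ω : ℝ) :
    ‖p.toPlane ω - q.toPlane ω‖ ^ 2 ≤ distSq p q := by
  rw [norm_toPlane_sub_sq, distSq]
  have := mul_le_mul_of_nonneg_left (cosAngle_le_cos p.angle q.angle)
    (mul_nonneg p.radius_nonneg q.radius_nonneg)
  linarith

theorem distSq_nonneg (p q : ConePoint) : 0 ≤ distSq p q :=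
  (sq_nonneg _).trans (norm_sq_le_distSq p q 0)

theorem distSq_of_pi_le {p q : ConePoint} (h : Real.pi ≤ |p.angle - q.angle|) :
    distSq p q = (p.radius + q.radius) ^ 2 := by
  rw [distSq, cosAngle_of_ge h]; ring

theorem distSq_of_le_pi {p q : ConePoint} (h : |p.angle - q.angle| ≤ Real.pi) (ω : ℝ) :
    distSq p q = ‖p.toPlane ω - q.toPlane ω‖ ^ 2 := by
  rw [norm_toPlane_sub_sq, distSq, cosAngle_of_le h]

/-- Orthogonal projection to the ray of `p`. Two such bounds add up to the triangle inequality when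
the outer points span an angle at least `π`. -/
theorem radius_sub_le (p q : ConePoint) :
    p.radius - q.radius * cosAngle p.angle q.angle ≤ √(distSq p q) := by
  refine Real.le_sqrt_of_sq_le ?_
  rw [distSq]
  have h₁ := cosAngle_le_one p.angle q.angle
  have h₂ := neg_one_le_cosAngle p.angle q.angle
  have : 0 ≤ q.radius ^ 2 * (1 - cosAngle p.angle q.angle ^ 2) :=
    mul_nonneg (sq_nonneg _) (by nlinarith)
  nlinarith

theorem distSq_comm (p q : ConePoint) : distSq p q = distSq q p := by
  rw [distSq, distSq, cosAngle_comm]; ring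

noncomputable instance : PseudoMetricSpace ConePoint where
  dist p q := √(distSq p q)
  dist_self p := by
    rw [distSq, cosAngle_self]; ring_nf; simp
  dist_comm p q := by rw [distSq_comm]
  dist_triangle p q r := by
    rcases le_total |p.angle - r.angle| Real.pi with h | h
    · rw [distSq_of_le_pi h 0, Real.sqrt_sq (norm_nonneg _)]
      have h₁ := Real.le_sqrt_of_sq_le (norm_sq_le_distSq p q 0)
      have h₂ := Real.le_sqrt_of_sq_le (norm_sq_le_distSq q r 0)
      have h₃ := norm_sub_le_norm_sub_add_norm_sub (p.toPlane 0) (q.toPlane 0) (r.toPlane 0)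
      linarith
    · rw [distSq_of_pi_le h, Real.sqrt_sq (add_nonneg p.radius_nonneg r.radius_nonneg)]
      have h₁ := radius_sub_le p q
      have h₂ := radius_sub_le r q
      rw [distSq_comm, cosAngle_comm] at h₂
      have h₃ := cosAngle_add_nonpos (h.trans (abs_sub_le p.angle q.angle r.angle))
      have h₄ := mul_nonneg q.radius_nonneg (neg_nonneg.2 h₃)
      linarith

theorem dist_sq_eq (p q : ConePoint) : dist p q ^ 2 = distSq p q :=
  Real.sq_sqrt (distSq_nonneg p q)

theorem dist_of_pi_le {p q : ConePoint} (h : Real.pi ≤ |p.angle - q.angle|) :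
    dist p q = p.radius + q.radius := by
  change √(distSq p q) = _
  rw [distSq_of_pi_le h, Real.sqrt_sq (add_nonneg p.radius_nonneg q.radius_nonneg)]

theorem dist_of_le_pi {p q : ConePoint} (h : |p.angle - q.angle| ≤ Real.pi) (ω : ℝ) :
    dist p q = ‖p.toPlane ω - q.toPlane ω‖ := by
  change √(distSq p q) = _
  rw [distSq_of_le_pi h ω, Real.sqrt_sq (norm_nonneg _)]

/-- The cone over the line is a CAT(0) space, in the form of the inequality of Bruhat and Tits for
an arbitrary point of a geodesic. -/
theorem exists_geodesic_point (a b : ConePoint) {t : ℝ} (ht : t ∈ Icc (0 : ℝ) 1) :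
    ∃ m : ConePoint, ∀ p : ConePoint, dist p m ^ 2
      ≤ (1 - t) * dist p a ^ 2 + t * dist p b ^ 2 - t * (1 - t) * dist a b ^ 2 := by
  obtain ⟨ht0, ht1⟩ := ht
  -- The square of the radius of `p` cancels. What depends on `p` is linear in its radius, so only
  -- its direction `s` matters.
  suffices h : ∃ m : ConePoint,
      m.radius ^ 2 = (1 - t) * a.radius ^ 2 + t * b.radius ^ 2 - t * (1 - t) * distSq a b ∧
      ∀ s : ℝ, (1 - t) * (a.radius * cosAngle s a.angle) + t * (b.radius * cosAngle s b.angle)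
        ≤ m.radius * cosAngle s m.angle by
    obtain ⟨m, hm, h⟩ := h
    refine ⟨m, fun p => ?_⟩
    have := mul_le_mul_of_nonneg_left (h p.angle) p.radius_nonneg
    rw [dist_sq_eq, dist_sq_eq, dist_sq_eq, dist_sq_eq, distSq.eq_1 p m, distSq.eq_1 p a,
      distSq.eq_1 p b]
    linarith
  have ha := a.radius_nonneg
  have hb := b.radius_nonneg
  rcases le_total Real.pi |a.angle - b.angle| with hab | hab
  · have hsum : ∀ s, cosAngle s a.angle + cosAngle s b.angle ≤ 0 := fun s => by
      rw [cosAngle_comm s a.angle]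
      exact cosAngle_add_nonpos (hab.trans (abs_sub_le _ _ _))
    -- The geodesic runs through the apex; the two cases are the two rays.
    rcases le_total (t * b.radius) ((1 - t) * a.radius) with h | h
    · refine ⟨⟨(1 - t) * a.radius - t * b.radius, a.angle, by linarith⟩, ?_, fun s => ?_⟩
      · simp only [distSq_of_pi_le hab]; ring
      · have := mul_nonneg (mul_nonneg ht0 hb) (neg_nonneg.2 (hsum s))
        simp only
        linarith
    · refine ⟨⟨t * b.radius - (1 - t) * a.radius, b.angle, by linarith⟩, ?_, fun s => ?_⟩
      · simp only [distSq_of_pi_le hab]; ring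
      · have := mul_nonneg (mul_nonneg (sub_nonneg.2 ht1) ha) (neg_nonneg.2 (hsum s))
        simp only
        linarith
  -- Measured from the bisector, both points lie in the right half plane, so the argument of the
  -- point `v` between them does too.
  · set ω := (a.angle + b.angle) / 2 with hω
    set v : ℂ := (1 - t : ℝ) * a.toPlane ω + (t : ℝ) * b.toPlane ω with hv
    have hre : v.re = (1 - t) * (a.radius * Real.cos (a.angle - ω))
        + t * (b.radius * Real.cos (b.angle - ω)) := by
      simp [hv, toPlane, -Complex.ofReal_sub]
    have him : v.im = (1 - t) * (a.radius * Real.sin (a.angle - ω))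
        + t * (b.radius * Real.sin (b.angle - ω)) := by
      simp [hv, toPlane, -Complex.ofReal_sub]
    obtain ⟨hab1, hab2⟩ := abs_le.1 hab
    have hca : 0 ≤ Real.cos (a.angle - ω) :=
      Real.cos_nonneg_of_neg_pi_div_two_le_of_le (by linarith) (by linarith)
    have hcb : 0 ≤ Real.cos (b.angle - ω) :=
      Real.cos_nonneg_of_neg_pi_div_two_le_of_le (by linarith) (by linarith)
    have hv0 : 0 ≤ v.re := by
      rw [hre]
      have := sub_nonneg.2 ht1
      positivity
    have harg := abs_le.1 (Complex.abs_arg_le_pi_div_two_iff.2 hv0)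
    refine ⟨⟨‖v‖, ω + v.arg, norm_nonneg _⟩, ?_, ?_⟩
    · simp only
      rw [distSq_of_le_pi hab ω, Complex.sq_norm, Complex.sq_norm, Complex.normSq_apply,
        Complex.normSq_apply, hre, him]
      simp only [toPlane, Complex.sub_re, Complex.sub_im]
      have h₁ := Real.sin_sq_add_cos_sq (a.angle - ω)
      have h₂ := Real.sin_sq_add_cos_sq (b.angle - ω)
      linear_combination (1 - t) * a.radius ^ 2 * h₁ + t * b.radius ^ 2 * h₂
    · have hlin : ∀ s, ‖v‖ * Real.cos (s - (ω + v.arg))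
          = (1 - t) * (a.radius * Real.cos (s - a.angle))
            + t * (b.radius * Real.cos (s - b.angle)) := by
        intro s
        have e1 : Real.cos (s - (ω + v.arg)) = Real.cos ((s - ω) - v.arg) := by congr 1; ring
        have e2 : Real.cos (s - a.angle) = Real.cos ((s - ω) - (a.angle - ω)) := by
          congr 1; ring
        have e3 : Real.cos (s - b.angle) = Real.cos ((s - ω) - (b.angle - ω)) := by
          congr 1; ring
        rw [e1, e2, e3, Real.cos_sub (s - ω) v.arg, Real.cos_sub (s - ω) (a.angle - ω),
          Real.cos_sub (s - ω) (b.angle - ω)]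
        have g1 := Complex.norm_mul_cos_arg v
        have g2 := Complex.norm_mul_sin_arg v
        rw [hre] at g1
        rw [him] at g2
        linear_combination Real.cos (s - ω) * g1 + Real.sin (s - ω) * g2
      intro s
      simp only
      rcases le_total |s - (ω + v.arg)| Real.pi with h | h
      · rw [cosAngle_of_le h, hlin]
        have h1 := mul_le_mul_of_nonneg_left (cosAngle_le_cos s a.angle)
          (mul_nonneg (sub_nonneg.2 ht1) ha)
        have h2 := mul_le_mul_of_nonneg_left (cosAngle_le_cos s b.angle) (mul_nonneg ht0 hb)
        linarith
      · have h0 := hlin (ω + v.arg)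
        rw [sub_self, Real.cos_zero] at h0
        rw [cosAngle_of_ge h]
        have h1 := mul_le_mul_of_nonneg_left (cosAngle_le_neg_cos
          (h.trans (abs_sub_le s a.angle _)) (by rw [abs_le]; constructor <;> linarith))
          (mul_nonneg (sub_nonneg.2 ht1) ha)
        have h2 := mul_le_mul_of_nonneg_left (cosAngle_le_neg_cos
          (h.trans (abs_sub_le s b.angle _)) (by rw [abs_le]; constructor <;> linarith))
          (mul_nonneg ht0 hb)
        linarith

end ConePoint

/-- Distances between points of two sides of a triangle in a CAT(0) space are at most the comparison
distances. -/
theorem dist_sq_le_cevianSq {X : Type*} [PseudoMetricSpace X] {o x y p q : X} {l m : ℝ}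
    (hm : m ∈ Icc (0 : ℝ) 1)
    (hp : ∀ z, dist z p ^ 2 ≤ (1 - l) * dist z o ^ 2 + l * dist z x ^ 2
      - l * (1 - l) * dist o x ^ 2)
    (hq : ∀ z, dist z q ^ 2 ≤ (1 - m) * dist z o ^ 2 + m * dist z y ^ 2
      - m * (1 - m) * dist o y ^ 2) :
    dist p q ^ 2 ≤ cevianSq l m (dist o x ^ 2) (dist o y ^ 2) (dist x y ^ 2) := by
  have h1 := hq p
  have h2 := mul_le_mul_of_nonneg_left (hp y) hm.1
  have h3 := mul_le_mul_of_nonneg_left (hp o) (sub_nonneg.2 hm.2)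
  rw [dist_self] at h3
  rw [dist_comm p o, dist_comm p y] at h1
  rw [dist_comm y o, dist_comm y x] at h2
  unfold cevianSq
  linarith

/-! ### Fans of triangles -/

/-- Metric data of a fan of `m - 1` triangles with common apex: `d k` is the distance from the apex
to the vertex `k`, `ℓ k` the one between the vertices `k` and `k + 1`, and `Δ i j` the one between
the vertices `i` and `j`, which exceeds the length of paths through the comparison triangles by at
most `C`. -/
structure FanData (m : ℕ) (d ℓ : ℕ → ℝ) (Δ : ℕ → ℕ → ℝ) (C : ℝ) : Prop where
  C_nonneg : 0 ≤ C
  d_nonneg : ∀ k, 0 ≤ d k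
  ℓ_nonneg : ∀ k, 0 ≤ ℓ k
  d_succ_le : ∀ k, d (k + 1) ≤ d k + ℓ k
  d_le : ∀ k, d k ≤ d (k + 1) + ℓ k
  ℓ_le : ∀ k, ℓ k ≤ d k + d (k + 1)
  Δ_le : ∀ i j, Δ i j ≤ d i + d j
  Δ_le_path : ∀ i j, i < j → j < m → ∀ l : ℕ → ℝ, (∀ k, i ≤ k → k ≤ j → 0 ≤ l k ∧ l k ≤ 1) →
    l i = 1 → l j = 1 → Δ i j ≤ ∑ k ∈ Finset.Ico i j,
      √(cevianSq (l k) (l (k + 1)) (d k ^ 2) (d (k + 1) ^ 2) (ℓ k ^ 2)) + C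

/-- A planar polygon, with the apex at the origin, that subembeds the data of a fan. -/
def HasPlanarFan (m : ℕ) (d ℓ : ℕ → ℝ) (Δ : ℕ → ℕ → ℝ) (C : ℝ) : Prop :=
  ∃ P : ℕ → ℂ, (∀ k, k + 1 = m ∨ k = 0 → k < m → ‖P k‖ = d k) ∧
    (∀ k, k + 1 < m → ‖P k - P (k + 1)‖ = ℓ k) ∧ (∀ k < m, d k ≤ ‖P k‖) ∧
    ∀ i j, i < j → j < m → Δ i j ≤ ‖P i - P j‖ + C

/-- The points `c k (l k)` chain `y i` to `y j` in at most `m - 1` steps, each with error `C`. Ends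
agree only up to distance `0`, since the cone is merely a pseudometric space. -/
theorem fanData_of_dist {X : Type*} [PseudoMetricSpace X] (m : ℕ) (hm : 1 ≤ m) (o : X)
    (y : ℕ → X) (c : ℕ → ℝ → X) {C : ℝ} (hC : 0 ≤ C) (hc : ∀ k < m, dist (c k 1) (y k) = 0)
    (h : ∀ k, k + 1 < m → ∀ s ∈ Icc (0 : ℝ) 1, ∀ t ∈ Icc (0 : ℝ) 1,
      dist (c k s) (c (k + 1) t) ≤ √(cevianSq s t (dist o (y k) ^ 2) (dist o (y (k + 1)) ^ 2)
        (dist (y k) (y (k + 1)) ^ 2)) + C) :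
    FanData m (fun k => dist o (y k)) (fun k => dist (y k) (y (k + 1)))
      (fun i j => dist (y i) (y j)) (((m : ℝ) - 1) * C) where
  C_nonneg := mul_nonneg (by rw [sub_nonneg]; exact_mod_cast hm) hC
  d_nonneg _ := dist_nonneg
  ℓ_nonneg _ := dist_nonneg
  d_succ_le _ := dist_triangle _ _ _
  d_le k := by rw [dist_comm (y k)]; exact dist_triangle _ _ _
  ℓ_le _ := dist_triangle_left _ _ _
  Δ_le _ _ := dist_triangle_left _ _ _
  Δ_le_path i j hij hj l hl hi1 hj1 := by
    have h1 : dist (y i) (y j) ≤ dist (c i (l i)) (c j (l j)) := by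
      have e1 := hc i (by omega)
      have e2 := hc j hj
      have t1 := dist_triangle4_left (c i 1) (c j 1) (y i) (y j)
      rw [hi1, hj1]
      linarith [dist_comm (c i 1) (y i)]
    refine h1.trans ((dist_le_Ico_sum_of_dist_le (f := fun k => c k (l k)) hij.le
      (d := fun k => √(cevianSq (l k) (l (k + 1)) (dist o (y k) ^ 2) (dist o (y (k + 1)) ^ 2)
        (dist (y k) (y (k + 1)) ^ 2)) + C)
      fun {k} h1 h2 => h k (by omega) _ (hl k h1 h2.le) _ (hl (k + 1) (by omega) h2)).trans ?_)
    rw [Finset.sum_add_distrib, Finset.sum_const, Nat.card_Ico, nsmul_eq_mul]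
    have : ((j - i : ℕ) : ℝ) ≤ (m : ℝ) - 1 := by
      rw [le_sub_iff_add_le]; exact_mod_cast (by omega : j - i + 1 ≤ m)
    have := mul_le_mul_of_nonneg_right this hC
    linarith

open ConePoint in
/-- Fan data with nondegenerate triangles subembed in the Euclidean cone over the line. -/
theorem FanData.exists_conePoint {m : ℕ} {d ℓ : ℕ → ℝ} {Δ : ℕ → ℕ → ℝ} {C : ℝ}
    (h : FanData m d ℓ Δ C) (hd : ∀ k, 0 < d k) (hℓ : ∀ k, 0 < ℓ k)
    (h₁ : ∀ k, d (k + 1) < d k + ℓ k) (h₂ : ∀ k, d k < d (k + 1) + ℓ k)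
    (h₃ : ∀ k, ℓ k < d k + d (k + 1)) :
    ∃ z : ℕ → ConePoint, (∀ k, k + 1 = m ∨ k = 0 → k < m → (z k).radius = d k) ∧
      Monotone (fun k => (z k).angle) ∧ (z 0).angle = 0 ∧
      (∀ k, k + 1 < m → dist (z k) (z (k + 1)) = ℓ k) ∧ (∀ k < m, d k ≤ (z k).radius) ∧
      ∀ i j, i < j → j < m → Δ i j ≤ dist (z i) (z j) + C := by
  obtain ⟨ρ, hρd, hρe, hρt, hρc⟩ := exists_concave_envelope m d ℓ hd hℓ h₁ h₂
  set α : ℕ → ℝ := fun k =>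
    Real.arccos ((ρ k ^ 2 + ρ (k + 1) ^ 2 - ℓ k ^ 2) / (2 * ρ k * ρ (k + 1))) with hα
  obtain ⟨Θ, hΘ0, hΘ⟩ : ∃ Θ : ℕ → ℝ, Θ 0 = 0 ∧ ∀ k, Θ (k + 1) = Θ k + α k :=
    ⟨fun k => ∑ j ∈ Finset.range k, α j, by simp, fun k => Finset.sum_range_succ _ _⟩
  have hΘm : Monotone Θ := monotone_nat_of_le_succ fun k => by
    rw [hΘ]; linarith [Real.arccos_nonneg ((ρ k ^ 2 + ρ (k + 1) ^ 2 - ℓ k ^ 2) /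
      (2 * ρ k * ρ (k + 1)))]
  have hρ0 : ∀ k < m, 0 < ρ k := fun k hk => (hd k).trans_le (hρd k hk)
  have hcos : ∀ k, k + 1 < m →
      2 * ρ k * ρ (k + 1) * Real.cos (α k) = ρ k ^ 2 + ρ (k + 1) ^ 2 - ℓ k ^ 2 ∧
      0 < Real.sin (α k) ∧ α k ≤ Real.pi := by
    intro k hk
    have p1 := hρ0 k (by omega)
    have p2 := hρ0 (k + 1) hk
    obtain ⟨t1, t2⟩ := hρt k hk
    have t3 : ℓ k < ρ k + ρ (k + 1) := by linarith [h₃ k, hρd k (by omega), hρd (k + 1) hk]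
    have hl := hℓ k
    have c1 : -1 < (ρ k ^ 2 + ρ (k + 1) ^ 2 - ℓ k ^ 2) / (2 * ρ k * ρ (k + 1)) := by
      rw [lt_div_iff₀ (by positivity)]
      nlinarith
    have c2 : (ρ k ^ 2 + ρ (k + 1) ^ 2 - ℓ k ^ 2) / (2 * ρ k * ρ (k + 1)) < 1 := by
      rw [div_lt_one (by positivity)]
      nlinarith
    refine ⟨?_, ?_, Real.arccos_le_pi _⟩
    · rw [hα, Real.cos_arccos c1.le c2.le]; field_simp
    · exact Real.sin_pos_of_pos_of_lt_pi (Real.arccos_pos.2 c2)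
        (lt_of_le_of_ne (Real.arccos_le_pi _) fun h => by
          rw [Real.arccos_eq_pi] at h; linarith)
  -- The absolute value serves the indices `k ≥ m`, where nothing is known about `ρ`.
  set z : ℕ → ConePoint := fun k => ⟨|ρ k|, Θ k, abs_nonneg _⟩ with hz
  have hzr : ∀ k < m, (z k).radius = ρ k := fun k hk => abs_of_pos (hρ0 k hk)
  refine ⟨z, fun k hk hkm => (hzr k hkm).trans (hρe k hk hkm), hΘm, hΘ0, ?_,
    fun k hk => (hρd k hk).trans (hzr k hk).ge, ?_⟩
  · intro k hk
    obtain ⟨e1, -, e3⟩ := hcos k hk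
    have ha : (z (k + 1)).angle - (z k).angle = α k := by
      simp only [hz, hΘ]; ring
    have : dist (z k) (z (k + 1)) ^ 2 = ℓ k ^ 2 := by
      rw [dist_sq_eq, distSq, cosAngle_comm, cosAngle_of_le, ha, hzr k (by omega),
        hzr (k + 1) hk, e1]
      · ring
      · rw [ha, abs_of_nonneg (Real.arccos_nonneg _)]; exact e3
    exact (pow_left_inj₀ dist_nonneg (hℓ k).le two_ne_zero).1 this
  · intro i j hij hj
    rcases le_or_gt Real.pi (Θ j - Θ i) with hpi | hpi
    · have : dist (z i) (z j) = (z i).radius + (z j).radius := by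
        refine dist_of_pi_le ?_
        rw [abs_sub_comm]
        exact hpi.trans (le_abs_self _)
      rw [this, hzr i (by omega), hzr j hj]
      linarith [h.Δ_le i j, hρd i (by omega), hρd j hj, h.C_nonneg]
    have hlt : Θ i < Θ j := by
      have := hΘm (show i + 1 ≤ j from hij)
      have h1 : 0 < α i := by
        refine lt_of_le_of_ne (Real.arccos_nonneg _) fun h0 => ?_
        have := (hcos i (by omega)).2.1
        simp only [← h0] at this
        simp at this
      linarith [hΘ i]
    -- The axis is turned until vertices `i` and `j` have equal height. The interval for `ω` keeps
    -- the chain between them above the axis.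
    obtain ⟨ω, ⟨hω1, hω2⟩, hω⟩ : ∃ ω ∈ Ioo (Θ j - Real.pi) (Θ i),
        ρ i * Real.sin (Θ i - ω) - ρ j * Real.sin (Θ j - ω) = 0 := by
      have hcont : ContinuousOn (fun ω => ρ i * Real.sin (Θ i - ω) - ρ j * Real.sin (Θ j - ω))
          (Icc (Θ j - Real.pi) (Θ i)) := by fun_prop
      refine intermediate_value_Ioo' (by linarith) hcont ⟨?_, ?_⟩
      · have := mul_pos (hρ0 j hj) (Real.sin_pos_of_pos_of_lt_pi (x := Θ j - Θ i) (by linarith) hpi)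
        simp only [sub_self, Real.sin_zero]
        linarith
      · have := mul_pos (hρ0 i (by omega)) (Real.sin_pos_of_pos_of_lt_pi
          (x := Θ i - (Θ j - Real.pi)) (by linarith) (by linarith))
        simp only [sub_sub_cancel, Real.sin_pi]
        linarith
    set X : ℕ → ℝ := fun k => ρ k * Real.cos (Θ k - ω) with hX
    set Y : ℕ → ℝ := fun k => ρ k * Real.sin (Θ k - ω) with hY
    have hr : ∀ k, X k ^ 2 + Y k ^ 2 = ρ k ^ 2 := fun k => by
      simp only [hX, hY]
      linear_combination ρ k ^ 2 * Real.sin_sq_add_cos_sq (Θ k - ω)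
    have hdiff : ∀ k, α k = (Θ (k + 1) - ω) - (Θ k - ω) := fun k => by rw [hΘ]; ring
    have hA : ∀ k, k + 1 < m → 0 < X k * Y (k + 1) - X (k + 1) * Y k := by
      intro k hk
      have := mul_pos (mul_pos (hρ0 k (by omega)) (hρ0 (k + 1) hk)) (hcos k hk).2.1
      rw [hdiff, Real.sin_sub] at this
      simp only [hX, hY]
      linarith
    have hL : ∀ k, k + 1 < m → (X (k + 1) - X k) ^ 2 + (Y (k + 1) - Y k) ^ 2 = ℓ k ^ 2 := by
      intro k hk
      have e := (hcos k hk).1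
      rw [hdiff, Real.cos_sub] at e
      have e1 := hr k
      have e2 := hr (k + 1)
      simp only [hX, hY] at e1 e2 ⊢
      linear_combination e1 + e2 - e
    have hturn : ∀ k, k + 2 < m →
        0 ≤ (X (k + 1) - X k) * (Y (k + 2) - Y (k + 1))
          - (Y (k + 1) - Y k) * (X (k + 2) - X (k + 1)) ∧
        (d (k + 1) ^ 2 = X (k + 1) ^ 2 + Y (k + 1) ^ 2 ∨
          (X (k + 1) - X k) * (Y (k + 2) - Y (k + 1))
            - (Y (k + 1) - Y k) * (X (k + 2) - X (k + 1)) = 0) := by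
      intro k hk
      have t := turn_of_concave (p₁ := X (k + 1)) (p₂ := Y (k + 1)) (hℓ k) (hℓ (k + 1))
        (hL k (by omega)) (hL (k + 1) hk)
        (by have := hA k (by omega); linarith) (by have := hA (k + 1) hk; linarith)
      obtain ⟨c1, c2⟩ := hρc k hk
      have l1 := hL k (by omega)
      have l2 := hL (k + 1) hk
      rw [← hr k, ← hr (k + 1), ← hr (k + 2)] at c1 c2
      have u2 : 2 * (X (k + 1) * (X (k + 1) - X k) + Y (k + 1) * (Y (k + 1) - Y k))
          = X (k + 1) ^ 2 + Y (k + 1) ^ 2 + ℓ k ^ 2 - (X k ^ 2 + Y k ^ 2) := by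
        rw [← l1]; ring
      have v2 : 2 * (X (k + 1) * (X (k + 2) - X (k + 1)) + Y (k + 1) * (Y (k + 2) - Y (k + 1)))
          = X (k + 2) ^ 2 + Y (k + 2) ^ 2 - ℓ (k + 1) ^ 2 - (X (k + 1) ^ 2 + Y (k + 1) ^ 2) := by
        rw [← l2]; ring
      refine ⟨t.1 ?_, c2.imp (fun h0 => by rw [hr, h0]) fun h0 => t.2 ?_⟩
      · have : ℓ (k + 1) * (2 * (X (k + 1) * (X (k + 1) - X k)
            + Y (k + 1) * (Y (k + 1) - Y k)))
          - ℓ k * (2 * (X (k + 1) * (X (k + 2) - X (k + 1))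
            + Y (k + 1) * (Y (k + 2) - Y (k + 1)))) ≥ 0 := by
          rw [u2, v2]; linarith
        linarith
      · have : ℓ (k + 1) * (2 * (X (k + 1) * (X (k + 1) - X k)
            + Y (k + 1) * (Y (k + 1) - Y k)))
          - ℓ k * (2 * (X (k + 1) * (X (k + 2) - X (k + 1))
            + Y (k + 1) * (Y (k + 2) - Y (k + 1)))) = 0 := by
          rw [u2, v2]; linarith
        linarith
    obtain ⟨l, hl, hli, hlj, hsum⟩ := exists_path_le_chord hij X Y (fun k => d k ^ 2)
      (fun k hk1 hk2 => mul_pos (hρ0 k (by omega)) (Real.sin_pos_of_pos_of_lt_pi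
        (by linarith [hΘm hk1]) (by linarith [hΘm hk2])))
      (fun k _ hk2 => hA k (by omega))
      (fun k _ hk2 => by
        rw [hr]; exact pow_le_pow_left₀ (hd k).le (hρd k (by omega)) 2)
      (fun k s t _ hk2 hs ht => by
        rw [hL k (by omega)]
        exact cevianSq_nonneg hs ht (h₂ k).le (h₁ k).le)
      (fun k _ hk2 => (hturn k (by omega)).1) (fun k _ hk2 => (hturn k (by omega)).2)
      (sub_eq_zero.1 hω)
    have hpath := h.Δ_le_path i j hij hj l hl hli hlj
    have hXX : X i - X j ≤ dist (z i) (z j) := by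
      rw [dist_of_le_pi (ω := ω) (by rw [abs_le]; constructor <;> simp only [hz] <;> linarith)]
      refine le_trans (le_of_eq ?_) (Complex.re_le_norm _)
      simp only [toPlane, Complex.sub_re, hzr i (by omega), hzr j hj]
      rfl
    have hcongr : ∑ k ∈ Finset.Ico i j, √(cevianSq (l k) (l (k + 1)) (d k ^ 2) (d (k + 1) ^ 2)
          (ℓ k ^ 2)) = ∑ k ∈ Finset.Ico i j, √(cevianSq (l k) (l (k + 1)) (d k ^ 2)
          (d (k + 1) ^ 2) ((X (k + 1) - X k) ^ 2 + (Y (k + 1) - Y k) ^ 2)) :=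
      Finset.sum_congr rfl fun k hk => by
        rw [hL k (by have := (Finset.mem_Ico.1 hk).2; omega)]
    linarith

/-! ### Planar polygons, by induction on the number of nodes -/

open ConePoint in
/-- Points of the cone over the line, the first of which is the apex, subembed in the plane if the
total angle is at least `π` and if the points other than the apex do. -/
theorem exists_planar_of_pi_le {m : ℕ} (z : ℕ → ConePoint)
    (hpi : Real.pi ≤ (z (m + 1)).angle - (z 0).angle)
    (hr : 0 < (z 0).radius)
    (hQ : HasPlanarFan (m + 1) (fun k => dist (z 0) (z (k + 1)))
      (fun k => dist (z (k + 1)) (z (k + 2))) (fun i j => dist (z (i + 1)) (z (j + 1))) 0) :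
    ∃ P : ℕ → ℂ, (∀ k, k = m + 1 ∨ k = 0 → ‖P k‖ = (z k).radius) ∧
      (∀ k, k < m + 1 → ‖P k - P (k + 1)‖ = dist (z k) (z (k + 1))) ∧
      (∀ k < m + 2, (z k).radius ≤ ‖P k‖) ∧
      ∀ i j, i < j → j < m + 2 → dist (z i) (z j) ≤ ‖P i - P j‖ := by
  obtain ⟨Q, hQ1, hQ2, hQ3, hQ4⟩ := hQ
  set a := (z 0).radius with ha
  set b := (z (m + 1)).radius with hb
  have hb0 : 0 ≤ b := (z (m + 1)).radius_nonneg
  have hN : ‖Q m‖ = a + b := by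
    rw [hQ1 m (Or.inl rfl) (by omega)]
    exact dist_of_pi_le (by rw [abs_sub_comm]; exact hpi.trans (le_abs_self _))
  -- `Q` has the point `z 0` at the origin. The old apex becomes the point `c` of `[0, Q m]` at
  -- distance `a` from the origin, and `P` moves it to the origin.
  set t := a / (a + b) with ht
  have hta : t * (a + b) = a := div_mul_cancel₀ _ (by positivity)
  have ht0 : 0 ≤ t := by positivity
  have ht1 : t ≤ 1 := (div_le_one (by positivity)).2 (by linarith)
  set c : ℂ := (t : ℂ) * Q m with hc
  have hR0 : ‖c‖ = a := by
    rw [hc, norm_mul, hN, Complex.norm_real, Real.norm_of_nonneg ht0, hta]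
  set P : ℕ → ℂ := fun k => Nat.casesOn k (-c) fun i => Q i - c with hP
  have hP0 : P 0 = -c := rfl
  have hPs : ∀ k, P (k + 1) = Q k - c := fun k => rfl
  have hPm : ‖P (m + 1)‖ = b := by
    have : P (m + 1) = ((1 - t : ℝ) : ℂ) * Q m := by rw [hPs, hc]; push_cast; ring
    rw [this, norm_mul, hN, Complex.norm_real, Real.norm_of_nonneg (by linarith)]
    linarith
  refine ⟨P, ?_, ?_, ?_, ?_⟩
  · rintro k (rfl | rfl)
    · exact hPm
    · rw [hP0, norm_neg, hR0]
  · intro k hk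
    rcases k with _ | k
    · rw [hP0, hPs, show -c - (Q 0 - c) = -Q 0 by ring, norm_neg]
      exact hQ1 0 (Or.inr rfl) (by omega)
    · rw [hPs, hPs, sub_sub_sub_cancel_right]
      exact hQ2 k (by omega)
  · intro k hk
    rcases k with _ | k
    · rw [hP0, norm_neg, hR0]
    -- Stewart's identity for the cevian to `c`. Of its lower bound in terms of cone distances, the
    -- angles contribute a nonnegative amount, as they sum to at least `π`, and the terms in `a`,
    -- `b` alone cancel.
    · have hst : ‖P (k + 1)‖ ^ 2
          = (1 - t) * ‖Q k‖ ^ 2 + t * ‖Q k - Q m‖ ^ 2 - t * (1 - t) * (a + b) ^ 2 := by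
        rw [← hN, hPs, hc]
        simp only [Complex.sq_norm, Complex.normSq_apply, Complex.sub_re, Complex.sub_im,
          Complex.re_ofReal_mul, Complex.im_ofReal_mul]
        ring
      have h1 := pow_le_pow_left₀ dist_nonneg (hQ3 k (by omega)) 2
      have h2 : dist (z (k + 1)) (z (m + 1)) ≤ ‖Q k - Q m‖ := by
        rcases eq_or_lt_of_le (show k ≤ m by omega) with rfl | hkm
        · simp
        · simpa using hQ4 k m hkm (by omega)
      have h2 := pow_le_pow_left₀ dist_nonneg h2 2
      have h3 := cosAngle_add_nonpos (s := (z 0).angle) (t := (z (m + 1)).angle)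
        (u := (z (k + 1)).angle) (by
          refine (hpi.trans (le_abs_self _)).trans ?_
          rw [abs_sub_comm]; exact abs_sub_le _ _ _)
      rw [dist_sq_eq, distSq, ← ha] at h1
      rw [dist_sq_eq, distSq, ← hb] at h2
      refine (sq_le_sq₀ (z (k + 1)).radius_nonneg (norm_nonneg _)).1 ?_
      rw [hst]
      have h1' := mul_le_mul_of_nonneg_left h1 (sub_nonneg.2 ht1)
      have h2' := mul_le_mul_of_nonneg_left h2 ht0
      have h4 := mul_nonneg (mul_nonneg (mul_nonneg (sub_nonneg.2 ht1) hr.le)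
        (z (k + 1)).radius_nonneg) (neg_nonneg.2 h3)
      have htb : t * b = (1 - t) * a := by linarith
      have e : (1 - t) * a ^ 2 + t * b ^ 2 - t * (1 - t) * (a + b) ^ 2 = 0 := by
        have : (1 - t) * a ^ 2 + t * b ^ 2 - t * (1 - t) * (a + b) ^ 2
          = (t * b - (1 - t) * a) ^ 2 := by ring
        rw [this, htb]; ring
      have f : t * (2 * (z (k + 1)).radius * b
          * cosAngle (z (k + 1)).angle (z (m + 1)).angle) = 2 * (z (k + 1)).radius
          * ((1 - t) * a) * cosAngle (z (k + 1)).angle (z (m + 1)).angle := by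
        rw [← htb]; ring
      nlinarith
  · intro i j hij hj
    obtain ⟨j, rfl⟩ : ∃ j', j = j' + 1 := ⟨j - 1, by omega⟩
    rcases i with _ | i
    · rw [hP0, hPs, show -c - (Q j - c) = -Q j by ring, norm_neg]
      exact hQ3 j (by omega)
    · rw [hPs, hPs, sub_sub_sub_cancel_right]
      simpa using hQ4 i j (by omega) (by omega)

open ConePoint in
-- By the CAT(0) inequality, points on geodesics from `o` satisfy the triangle comparison without
-- error, so the induction hypothesis applies with constant `0`.
theorem hasPlanarFan_conePoint {m : ℕ} (hm : 1 ≤ m)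
    (ih : ∀ d ℓ Δ C, FanData m d ℓ Δ C → HasPlanarFan m d ℓ Δ C) (o : ConePoint)
    (y : ℕ → ConePoint) : HasPlanarFan m (fun k => dist o (y k))
      (fun k => dist (y k) (y (k + 1))) (fun i j => dist (y i) (y j)) 0 := by
  have hg : ∀ k, ∀ t : ℝ, ∃ p : ConePoint, t ∈ Icc (0 : ℝ) 1 → ∀ q, dist q p ^ 2
      ≤ (1 - t) * dist q o ^ 2 + t * dist q (y k) ^ 2 - t * (1 - t) * dist o (y k) ^ 2 := by
    intro k t
    by_cases ht : t ∈ Icc (0 : ℝ) 1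
    · obtain ⟨p, hp⟩ := exists_geodesic_point o (y k) ht
      exact ⟨p, fun _ => hp⟩
    · exact ⟨o, fun h => absurd h ht⟩
  choose c hc using hg
  have := ih _ _ _ _ (fanData_of_dist m hm o y c le_rfl (fun k _ => ?_) fun k _ s hs t ht => ?_)
  · simpa using this
  · have := hc k 1 ⟨zero_le_one, le_rfl⟩ (y k)
    simp only [sub_self, dist_self] at this
    rw [dist_comm]
    have h0 : dist (y k) (c k 1) ^ 2 ≤ 0 := by linarith
    exact pow_eq_zero_iff two_ne_zero |>.1 (le_antisymm h0 (sq_nonneg _))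
  · rw [add_zero]
    exact Real.le_sqrt_of_sq_le (dist_sq_le_cevianSq ht (hc k s hs) (hc (k + 1) t ht))

open ConePoint in
-- If the total angle at the apex is at most `π`, polar coordinates in the plane do. Otherwise the
-- fan is seen anew from `z 0`, which leaves `m` nodes.
theorem FanData.hasPlanarFan_of_pos {m : ℕ}
    (ih : ∀ d ℓ Δ C, FanData m d ℓ Δ C → HasPlanarFan m d ℓ Δ C) {d ℓ : ℕ → ℝ} {Δ : ℕ → ℕ → ℝ}
    {C : ℝ} (h : FanData (m + 1) d ℓ Δ C) (hd : ∀ k, 0 < d k) (hℓ : ∀ k, 0 < ℓ k)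
    (h₁ : ∀ k, d (k + 1) < d k + ℓ k) (h₂ : ∀ k, d k < d (k + 1) + ℓ k)
    (h₃ : ∀ k, ℓ k < d k + d (k + 1)) : HasPlanarFan (m + 1) d ℓ Δ C := by
  obtain ⟨z, hz1, hz2, hz3, hz4, hz5, hz6⟩ := h.exists_conePoint hd hℓ h₁ h₂ h₃
  rcases le_or_gt (z m).angle Real.pi with hpi | hpi
  · have hle : ∀ i j, i < j → j < m + 1 → |(z i).angle - (z j).angle| ≤ Real.pi := by
      intro i j hij hj
      have a1 := hz2 (Nat.zero_le i)
      have a2 := hz2 (show j ≤ m by omega)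
      have a3 := hz2 hij.le
      simp only at a1 a2 a3
      rw [abs_le]; constructor <;> linarith
    have hnorm : ∀ k, ‖(z k).toPlane 0‖ = (z k).radius := by
      intro k
      refine (pow_left_inj₀ (norm_nonneg _) (z k).radius_nonneg two_ne_zero).1 ?_
      rw [Complex.sq_norm, Complex.normSq_apply]
      simp only [toPlane]
      linear_combination (z k).radius ^ 2 * Real.sin_sq_add_cos_sq ((z k).angle - 0)
    refine ⟨fun k => (z k).toPlane 0, fun k hk hkm => (hnorm k).trans (hz1 k hk hkm),
      fun k hk => ?_, fun k hk => (hz5 k hk).trans (hnorm k).ge, fun i j hij hj => ?_⟩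
    · rw [← dist_of_le_pi (hle k (k + 1) (by omega) hk), hz4 k hk]
    · rw [← dist_of_le_pi (hle i j hij hj)]
      exact hz6 i j hij hj
  · have hm : 1 ≤ m := by
      by_contra! hm
      obtain rfl : m = 0 := by omega
      linarith [Real.pi_pos]
    obtain ⟨M, rfl⟩ : ∃ M, m = M + 1 := ⟨m - 1, by omega⟩
    obtain ⟨P, hP1, hP2, hP3, hP4⟩ := exists_planar_of_pi_le z (by linarith)
      (by rw [hz1 0 (Or.inr rfl) (by omega)]; exact hd 0)
      (hasPlanarFan_conePoint hm ih (z 0) fun k => z (k + 1))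
    refine ⟨P, fun k hk hkm => (hP1 k (by omega)).trans (hz1 k hk hkm),
      fun k hk => (hP2 k (by omega)).trans (hz4 k hk), fun k hk => (hz5 k hk).trans (hP3 k hk),
      fun i j hij hj => (hz6 i j hij hj).trans ?_⟩
    linarith [hP4 i j hij hj]

open Filter Topology in
/-- The limit of planar fans for perturbed data is a planar fan. -/
theorem hasPlanarFan_of_perturbed {m : ℕ} {d ℓ : ℕ → ℝ} {Δ : ℕ → ℕ → ℝ} {C : ℝ}
    (hd : ∀ k, 0 ≤ d k) (hℓ : ∀ k, 0 ≤ ℓ k)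
    (h : ∀ ε : ℝ, 0 < ε →
      HasPlanarFan m (fun k => √(d k ^ 2 + ε)) (fun k => √(ℓ k ^ 2 + ε)) Δ C) :
    HasPlanarFan m d ℓ Δ C := by
  have hpos : ∀ N : ℕ, (0 : ℝ) < 1 / ((N : ℝ) + 1) := fun N => Nat.one_div_pos_of_nat
  choose P hP1 hP2 hP3 hP4 using fun N : ℕ => h (1 / ((N : ℝ) + 1)) (hpos N)
  have hone : ∀ N : ℕ, 1 / ((N : ℝ) + 1) ≤ 1 := fun N => by
    rw [div_le_one (by positivity)]; linarith [N.cast_nonneg (α := ℝ)]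
  have hbound : ∀ k, ∃ R : ℝ, k < m → ∀ N, ‖P N k‖ ≤ R := by
    intro k
    induction k with
    | zero =>
      refine ⟨√(d 0 ^ 2 + 1), fun hk N => ?_⟩
      rw [hP1 N 0 (Or.inr rfl) hk]
      exact Real.sqrt_le_sqrt (by linarith [hone N])
    | succ k ih =>
      obtain ⟨R, hR⟩ := ih
      refine ⟨R + √(ℓ k ^ 2 + 1), fun hk N => ?_⟩
      have h1 := hR (by omega) N
      have h2 := hP2 N k hk
      have h3 : √(ℓ k ^ 2 + 1 / ((N : ℝ) + 1)) ≤ √(ℓ k ^ 2 + 1) :=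
        Real.sqrt_le_sqrt (by linarith [hone N])
      have h4 := norm_le_norm_add_norm_sub (P N k) (P N (k + 1))
      linarith
  -- One ultrafilter gives limits at all nodes together, so no subsequences have to be chosen.
  have hlim : ∀ k, ∃ Q : ℂ, k < m →
      Tendsto (fun N => P N k) (hyperfilter ℕ : Filter ℕ) (𝓝 Q) := by
    intro k
    by_cases hk : k < m
    · obtain ⟨R, hR⟩ := hbound k
      obtain ⟨Q, -, hQ⟩ := (isCompact_closedBall (0 : ℂ) R).ultrafilter_le_nhds
        ((hyperfilter ℕ).map fun N => P N k)
        (by rw [Ultrafilter.coe_map, le_principal_iff, Filter.mem_map]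
            exact Filter.univ_mem' fun N => by simpa using hR hk N)
      exact ⟨Q, fun _ => hQ⟩
    · exact ⟨0, fun h => absurd h hk⟩
  choose Q hQ using hlim
  have hε : Tendsto (fun N : ℕ => 1 / ((N : ℝ) + 1)) (hyperfilter ℕ : Filter ℕ) (𝓝 0) :=
    tendsto_one_div_add_atTop_nhds_zero_nat.mono_left
      (hyperfilter_le_cofinite.trans Nat.cofinite_eq_atTop.le)
  have hsq : ∀ a : ℝ, 0 ≤ a → Tendsto (fun N : ℕ => √(a ^ 2 + 1 / ((N : ℝ) + 1)))
      (hyperfilter ℕ : Filter ℕ) (𝓝 a) := by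
    intro a ha
    have := (tendsto_const_nhds (x := a ^ 2)).add hε |>.sqrt
    rwa [add_zero, Real.sqrt_sq ha] at this
  refine ⟨Q, fun k hk hkm => ?_, fun k hk => ?_, fun k hk => ?_, fun i j hij hj => ?_⟩
  · refine tendsto_nhds_unique (hQ k hkm).norm ((hsq _ (hd k)).congr fun N => ?_)
    exact (hP1 N k hk hkm).symm
  · refine tendsto_nhds_unique ((hQ k (by omega)).sub (hQ (k + 1) hk)).norm
      ((hsq _ (hℓ k)).congr fun N => ?_)
    exact (hP2 N k hk).symm
  · exact le_of_tendsto_of_tendsto' (hsq _ (hd k)) (hQ k hk).norm fun N => hP3 N k hk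
  · exact ge_of_tendsto' (((hQ i (by omega)).sub (hQ j hj)).norm.add_const C)
      fun N => hP4 N i j hij hj

/-- Adding `ε` to all squared sides makes every triangle strict and adds `((l - m)² + l m) ε ≥ 0` to
`cevianSq`, so the paths only get longer. -/
theorem FanData.perturb {m : ℕ} {d ℓ : ℕ → ℝ} {Δ : ℕ → ℕ → ℝ} {C : ℝ}
    (h : FanData m d ℓ Δ C) {ε : ℝ} (hε : 0 < ε) :
    FanData m (fun k => √(d k ^ 2 + ε)) (fun k => √(ℓ k ^ 2 + ε)) Δ C ∧
    ∀ k, √(d (k + 1) ^ 2 + ε) < √(d k ^ 2 + ε) + √(ℓ k ^ 2 + ε) ∧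
      √(d k ^ 2 + ε) < √(d (k + 1) ^ 2 + ε) + √(ℓ k ^ 2 + ε) ∧
      √(ℓ k ^ 2 + ε) < √(d k ^ 2 + ε) + √(d (k + 1) ^ 2 + ε) := by
  have key : ∀ a b c : ℝ, 0 ≤ a → 0 ≤ b → 0 ≤ c → a ≤ b + c →
      √(a ^ 2 + ε) < √(b ^ 2 + ε) + √(c ^ 2 + ε) := by
    intro a b c ha hb hc habc
    have h1 : 0 < √(b ^ 2 + ε) := Real.sqrt_pos.2 (by positivity)
    have h2 : 0 < √(c ^ 2 + ε) := Real.sqrt_pos.2 (by positivity)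
    have h3 : b ≤ √(b ^ 2 + ε) := Real.le_sqrt_of_sq_le (by linarith)
    have h4 : c ≤ √(c ^ 2 + ε) := Real.le_sqrt_of_sq_le (by linarith)
    refine (Real.sqrt_lt' (by positivity)).2 ?_
    have h5 : √(b ^ 2 + ε) ^ 2 = b ^ 2 + ε := Real.sq_sqrt (by positivity)
    have h6 : √(c ^ 2 + ε) ^ 2 = c ^ 2 + ε := Real.sq_sqrt (by positivity)
    nlinarith [mul_le_mul h3 h4 hc h1.le, mul_self_le_mul_self ha habc]
  have hs : ∀ k, √(d (k + 1) ^ 2 + ε) < √(d k ^ 2 + ε) + √(ℓ k ^ 2 + ε) ∧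
      √(d k ^ 2 + ε) < √(d (k + 1) ^ 2 + ε) + √(ℓ k ^ 2 + ε) ∧
      √(ℓ k ^ 2 + ε) < √(d k ^ 2 + ε) + √(d (k + 1) ^ 2 + ε) := fun k =>
    ⟨key _ _ _ (h.d_nonneg _) (h.d_nonneg _) (h.ℓ_nonneg _) (h.d_succ_le k),
      key _ _ _ (h.d_nonneg _) (h.d_nonneg _) (h.ℓ_nonneg _) (h.d_le k),
      key _ _ _ (h.ℓ_nonneg _) (h.d_nonneg _) (h.d_nonneg _) (h.ℓ_le k)⟩
  refine ⟨⟨h.C_nonneg, fun _ => Real.sqrt_nonneg _, fun _ => Real.sqrt_nonneg _,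
    fun k => (hs k).1.le, fun k => (hs k).2.1.le, fun k => (hs k).2.2.le, fun i j => ?_,
    fun i j hij hj l hl hi hj' => ?_⟩, hs⟩
  · refine (h.Δ_le i j).trans (add_le_add ?_ ?_) <;>
      exact Real.le_sqrt_of_sq_le (by linarith)
  · refine (h.Δ_le_path i j hij hj l hl hi hj').trans
      (add_le_add (Finset.sum_le_sum fun k hk => Real.sqrt_le_sqrt ?_) le_rfl)
    obtain ⟨hk1, hk2⟩ := Finset.mem_Ico.1 hk
    rw [Real.sq_sqrt (by positivity), Real.sq_sqrt (by positivity), Real.sq_sqrt (by positivity)]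
    have h1 := mul_nonneg (mul_nonneg (hl k hk1 hk2.le).1 (hl (k + 1) (by omega) hk2).1) hε.le
    have h2 := mul_nonneg (sq_nonneg (l k - l (k + 1))) hε.le
    unfold cevianSq
    linarith

theorem FanData.hasPlanarFan (m : ℕ) : ∀ d ℓ Δ C, FanData m d ℓ Δ C → HasPlanarFan m d ℓ Δ C := by
  induction m with
  | zero => exact fun d ℓ Δ C _ => ⟨0, by simp, by simp, by simp, by simp⟩
  | succ m ih =>
    intro d ℓ Δ C h
    refine hasPlanarFan_of_perturbed h.d_nonneg h.ℓ_nonneg fun ε hε => ?_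
    obtain ⟨h', hs⟩ := h.perturb hε
    exact h'.hasPlanarFan_of_pos ih (fun k => Real.sqrt_pos.2 (by positivity))
      (fun k => Real.sqrt_pos.2 (by positivity)) (fun k => (hs k).1) (fun k => (hs k).2.1)
      fun k => (hs k).2.2

/-! ### Comparison triangles and short segments -/

/-- A comparison triangle with one vertex at the origin. -/
theorem exists_comparison_triangle {a b c : ℝ} (ha : 0 ≤ a) (hb : 0 ≤ b) (hc : 0 ≤ c)
    (h₁ : a ≤ b + c) (h₂ : b ≤ a + c) (h₃ : c ≤ a + b) :
    ∃ B C : ℂ, ‖B‖ = a ∧ ‖C‖ = b ∧ ‖B - C‖ = c := by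
  rcases eq_or_lt_of_le ha with rfl | ha'
  · exact ⟨0, b, by simp, by simp [abs_of_nonneg hb], by
      rw [zero_sub, norm_neg, Complex.norm_real, Real.norm_of_nonneg hb]; linarith⟩
  set u := (a ^ 2 + b ^ 2 - c ^ 2) / (2 * a) with hu
  have hua : 2 * a * u = a ^ 2 + b ^ 2 - c ^ 2 := by rw [hu]; field_simp
  have hub : u ^ 2 ≤ b ^ 2 := by
    refine sq_le_sq' ?_ ?_
    · rw [hu, le_div_iff₀ (by positivity)]; nlinarith
    · rw [hu, div_le_iff₀ (by positivity)]; nlinarith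
  have hs : √(b ^ 2 - u ^ 2) ^ 2 = b ^ 2 - u ^ 2 := Real.sq_sqrt (by linarith)
  refine ⟨a, ⟨u, √(b ^ 2 - u ^ 2)⟩, by simp [abs_of_nonneg ha], ?_, ?_⟩
  · refine (pow_left_inj₀ (norm_nonneg _) hb two_ne_zero).1 ?_
    rw [Complex.sq_norm, Complex.normSq_apply]
    linarith
  · refine (pow_left_inj₀ (norm_nonneg _) hc two_ne_zero).1 ?_
    rw [Complex.sq_norm, Complex.normSq_apply]
    simp only [Complex.sub_re, Complex.sub_im, Complex.ofReal_re, Complex.ofReal_im]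
    linarith

namespace ShortSegment

variable {X : Type*} [MetricSpace X] {h h' : ℝ} {x y : X}

/-- An `h`-short segment is `h'`-short for all `h' ≥ h`. -/
def weaken (γ : ShortSegment h x y) (hh : h ≤ h') : ShortSegment h' x y where
  L := γ.L
  L_nonneg := γ.L_nonneg
  toFun := γ.toFun
  continuousOn := γ.continuousOn
  source := γ.source
  target := γ.target
  edist_le_length := γ.edist_le_length
  length_le := γ.length_le.trans (add_le_add_right (ENNReal.ofReal_le_ofReal hh) _)

theorem eVariationOn_comp_sub (f : ℝ → X) (L a b : ℝ) :
    eVariationOn (fun t => f (L - t)) (Icc a b) = eVariationOn f (Icc (L - b) (L - a)) := by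
  rw [← Set.image_const_sub_Icc]
  exact eVariationOn.comp_eq_of_antitoneOn f (fun t => L - t)
    fun s _ t _ hst => sub_le_sub_left hst L

/-- The same path run backwards. -/
def reverse (γ : ShortSegment h x y) : ShortSegment h y x where
  L := γ.L
  L_nonneg := γ.L_nonneg
  toFun t := γ.toFun (γ.L - t)
  continuousOn := γ.continuousOn.comp (by fun_prop) fun t ht =>
    ⟨sub_nonneg.2 ht.2, sub_le_self _ ht.1⟩
  source := by rw [sub_zero, γ.target]
  target := by rw [sub_self, γ.source]
  edist_le_length := by
    rw [eVariationOn_comp_sub, sub_self, sub_zero, edist_comm]; exact γ.edist_le_length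
  length_le := by
    rw [eVariationOn_comp_sub, sub_self, sub_zero, edist_comm]; exact γ.length_le

theorem edist_source_le (γ : ShortSegment h x y) {t : ℝ} (ht : t ∈ Icc 0 γ.L) :
    edist x (γ.toFun t) ≤ eVariationOn γ.toFun (Icc 0 t) := by
  have := eVariationOn.edist_le γ.toFun (s := Icc 0 t) ⟨le_rfl, ht.1⟩ ⟨ht.1, le_rfl⟩
  rwa [γ.source] at this

theorem edist_target_le (γ : ShortSegment h x y) {t : ℝ} (ht : t ∈ Icc 0 γ.L) :
    edist (γ.toFun t) y ≤ eVariationOn γ.toFun (Icc t γ.L) := by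
  have := eVariationOn.edist_le γ.toFun (s := Icc t γ.L) ⟨le_rfl, ht.2⟩ ⟨ht.2, le_rfl⟩
  rwa [γ.target] at this

/-- A point of a short segment dividing it in a given proportion. -/
theorem exists_param (γ : ShortSegment h x y) (s : ℝ) : ∃ t ∈ Icc 0 γ.L,
    (s = 1 → γ.toFun t = y) ∧ (s ∈ Icc (0 : ℝ) 1 →
      s * dist x y ≤ dist x (γ.toFun t) ∧ (1 - s) * dist x y ≤ dist (γ.toFun t) y) := by
  -- The end point is chosen explicitly: the path may reach distance `d(x, y)` from `x` before it
  -- reaches `y`.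
  by_cases h1 : s = 1
  · refine ⟨γ.L, ⟨γ.L_nonneg, le_rfl⟩, fun _ => γ.target, fun _ => ?_⟩
    rw [γ.target, h1]; simp
  by_cases hs : s ∈ Icc (0 : ℝ) 1
  · have hc : ContinuousOn (fun t => dist x (γ.toFun t)) (Icc 0 γ.L) :=
      (continuous_const.dist continuous_id).comp_continuousOn γ.continuousOn
    obtain ⟨t, ht, hts⟩ := intermediate_value_Icc γ.L_nonneg hc
      (show s * dist x y ∈ Icc (dist x (γ.toFun 0)) (dist x (γ.toFun γ.L)) by
        rw [γ.source, γ.target, dist_self]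
        exact ⟨mul_nonneg hs.1 dist_nonneg, mul_le_of_le_one_left dist_nonneg hs.2⟩)
    refine ⟨t, ht, fun h => absurd h h1, fun _ => ⟨hts.ge, ?_⟩⟩
    have := dist_triangle x (γ.toFun t) y
    simp only at hts
    linarith
  · exact ⟨0, ⟨le_rfl, γ.L_nonneg⟩, fun h => absurd h h1, fun h => absurd h hs⟩

theorem isComparisonPoint_of_le (γ : ShortSegment h x y) {t : ℝ} (ht : t ∈ Icc 0 γ.L)
    {a b q : Plane} (hq : q ∈ segment ℝ a b) (h₁ : dist a q ≤ dist x (γ.toFun t))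
    (h₂ : dist q b ≤ dist (γ.toFun t) y) : γ.IsComparisonPoint t a b q :=
  ⟨hq, (by rw [edist_dist, edist_dist]; exact ENNReal.ofReal_le_ofReal h₁ :
      edist a q ≤ edist x (γ.toFun t)).trans (γ.edist_source_le ht),
    (by rw [edist_dist, edist_dist]; exact ENNReal.ofReal_le_ofReal h₂ :
      edist q b ≤ edist (γ.toFun t) y).trans (γ.edist_target_le ht)⟩

end ShortSegment

/-! ### From rough CAT(0) to the `n`-point condition -/

theorem IsRoughCAT0With.dist_le {X : Type*} [MetricSpace X] {C : ℝ} {H : X → X → X → ℝ}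
    (hH : IsRoughCAT0With X C H) {x y z : X} (a : ShortSegment (H x y z) x y)
    (b : ShortSegment (H x y z) y z) (c : ShortSegment (H x y z) z x) {P Q R : Plane}
    (h₁ : dist P Q = dist x y) (h₂ : dist Q R = dist y z) (h₃ : dist P R = dist x z)
    {s t : ℝ} (hs : s ∈ Icc 0 a.L) (ht : t ∈ Icc 0 c.L) {u v : Plane}
    (hu : a.IsComparisonPoint s P Q u) (hv : c.IsComparisonPoint t R P v) :
    dist (a.toFun s) (c.toFun t) ≤ dist u v + C := by
  obtain ⟨-, -, -, h⟩ := hH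
  refine h ![x, y, z] (fun i => match i with | 0 => a | 1 => b | 2 => c) ![P, Q, R] ?_ 0 2
    (by decide) s hs t ht u v hu hv
  intro i j
  fin_cases i <;> fin_cases j <;> simp [h₁, h₂, h₃, dist_comm Q P, dist_comm R Q, dist_comm R P,
    dist_comm y x, dist_comm z y, dist_comm z x]

/-- Points of short segments from `o` to the points `y k`, with rough comparison of their distances
in the triangles `o`, `y k`, `y (k + 1)`. -/
theorem IsRoughCAT0With.exists_fan {X : Type*} [MetricSpace X] {C : ℝ} {H : X → X → X → ℝ}
    (hH : IsRoughCAT0With X C H) (m : ℕ) (o : X) (y : ℕ → X) :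
    ∃ c : ℕ → ℝ → X, (∀ k < m, dist (c k 1) (y k) = 0) ∧
      ∀ k, k + 1 < m → ∀ s ∈ Icc (0 : ℝ) 1, ∀ t ∈ Icc (0 : ℝ) 1,
        dist (c k s) (c (k + 1) t) ≤ √(cevianSq s t (dist o (y k) ^ 2)
          (dist o (y (k + 1)) ^ 2) (dist (y k) (y (k + 1)) ^ 2)) + C := by
  have hX := hH.2.1
  have hpos := hH.2.2.1
  -- One `h` serves all triangles, because an inner spoke is a side of two of them and has to be
  -- short enough for both.
  obtain ⟨h, h0, hh⟩ : ∃ h : ℝ, 0 < h ∧ ∀ k < m, h ≤ H o (y k) (y (k + 1)) := by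
    clear * - hpos
    induction m with
    | zero => exact ⟨1, one_pos, by simp⟩
    | succ m ih =>
      obtain ⟨h, h0, hh⟩ := ih
      refine ⟨min h (H o (y m) (y (m + 1))), lt_min h0 (hpos _ _ _), fun k hk => ?_⟩
      rcases Nat.lt_succ_iff_lt_or_eq.1 hk with hk | rfl
      · exact (min_le_left _ _).trans (hh k hk)
      · exact min_le_right _ _
  have γ : ∀ k, ShortSegment h o (y k) := fun k => (hX o (y k) h h0).some
  choose T hT hT1 hTs using fun k => (γ k).exists_param
  refine ⟨fun k s => (γ k).toFun (T k s), fun k _ => by simp only [hT1 k 1 rfl, dist_self], ?_⟩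
  intro k hk s hs t ht
  obtain ⟨B₀, D₀, hB₀, hD₀, hBD₀⟩ := exists_comparison_triangle (a := dist o (y k))
    (b := dist o (y (k + 1))) (c := dist (y k) (y (k + 1))) dist_nonneg dist_nonneg dist_nonneg
    (by rw [dist_comm (y k)]; exact dist_triangle _ _ _) (dist_triangle _ _ _)
    (dist_triangle_left _ _ _)
  set Φ := Complex.orthonormalBasisOneI.repr
  obtain ⟨B, hB⟩ : ∃ B, B = Φ B₀ := ⟨_, rfl⟩
  obtain ⟨D, hD⟩ : ∃ D, D = Φ D₀ := ⟨_, rfl⟩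
  have nB : ‖B‖ = dist o (y k) := by rw [hB, LinearIsometryEquiv.norm_map, hB₀]
  have nD : ‖D‖ = dist o (y (k + 1)) := by rw [hD, LinearIsometryEquiv.norm_map, hD₀]
  have nBD : ‖B - D‖ = dist (y k) (y (k + 1)) := by
    rw [hB, hD, ← map_sub, LinearIsometryEquiv.norm_map, hBD₀]
  have hle := hh k (by omega)
  have hself : ∀ (r : ℝ) (E : Plane), r ∈ Icc (0 : ℝ) 1 →
      dist 0 (r • E) = r * ‖E‖ ∧ dist (r • E) E = (1 - r) * ‖E‖ := by
    intro r E hr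
    constructor
    · rw [dist_zero_left, norm_smul, Real.norm_of_nonneg hr.1]
    · rw [dist_eq_norm, ← norm_neg, show -(r • E - E) = (1 - r) • E by module, norm_smul,
        Real.norm_of_nonneg (sub_nonneg.2 hr.2)]
  have hseg : ∀ (r : ℝ) (E : Plane), r ∈ Icc (0 : ℝ) 1 → r • E ∈ segment ℝ 0 E := by
    intro r E hr
    exact ⟨1 - r, r, sub_nonneg.2 hr.2, hr.1, by ring, by simp⟩
  have hdist : dist (s • B) (t • D) = √(cevianSq s t (dist o (y k) ^ 2)
      (dist o (y (k + 1)) ^ 2) (dist (y k) (y (k + 1)) ^ 2)) := by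
    rw [dist_eq_norm, ← Real.sqrt_sq (norm_nonneg (s • B - t • D)), ← nB, ← nD, ← nBD]
    congr 1
    rw [norm_sub_sq_real, norm_sub_sq_real, norm_smul, norm_smul, real_inner_smul_left,
      real_inner_smul_right, Real.norm_of_nonneg hs.1, Real.norm_of_nonneg ht.1, cevianSq]
    ring
  rw [← hdist]
  have hrev : (γ (k + 1)).reverse.toFun ((γ (k + 1)).L - T (k + 1) t)
      = (γ (k + 1)).toFun (T (k + 1) t) := by
    simp [ShortSegment.reverse]
  have hrevmem : (γ (k + 1)).L - T (k + 1) t ∈ Icc 0 (γ (k + 1)).reverse.L :=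
    ⟨sub_nonneg.2 (hT (k + 1) t).2, sub_le_self _ (hT (k + 1) t).1⟩
  have main := hH.dist_le ((γ k).weaken hle)
    ((hX (y k) (y (k + 1)) _ (hpos o (y k) (y (k + 1)))).some)
    ((γ (k + 1)).reverse.weaken hle) (P := 0) (Q := B) (R := D) (by rw [dist_zero_left, nB])
    (by rw [dist_eq_norm, nBD]) (by rw [dist_zero_left, nD]) (hT k s) hrevmem
    (u := s • B) (v := t • D)
    (((γ k).weaken hle).isComparisonPoint_of_le (hT k s) (hseg s B hs)
      (by rw [(hself s B hs).1, nB]; exact (hTs k s hs).1)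
      (by rw [(hself s B hs).2, nB]; exact (hTs k s hs).2))
    (((γ (k + 1)).reverse.weaken hle).isComparisonPoint_of_le hrevmem
      (by rw [segment_symm]; exact hseg t D ht)
      (by
        change _ ≤ dist _ ((γ (k + 1)).reverse.toFun _)
        rw [hrev, dist_comm, (hself t D ht).2, nD, dist_comm (y (k + 1))]
        exact (hTs (k + 1) t ht).2)
      (by
        change _ ≤ dist ((γ (k + 1)).reverse.toFun _) _
        rw [hrev, dist_comm, (hself t D ht).1, nD, dist_comm _ o]
        exact (hTs (k + 1) t ht).1))
  change _ ≤ _ at main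
  change dist ((γ k).toFun (T k s)) ((γ (k + 1)).reverse.toFun _) ≤ _ at main
  rwa [hrev] at main

/-- The `n - 1` points other than `x 1` span `n - 2` triangles with it, which gives the factor. -/
theorem IsRoughCAT0Star.roughNPointCondition {X : Type*} [MetricSpace X] {C : ℝ}
    (h : IsRoughCAT0Star X C) {n : ℕ} (hn : 3 ≤ n) :
    RoughNPointCondition X n (((n : ℝ) - 2) * C) := by
  obtain ⟨H, hH⟩ := h
  intro x hx
  obtain ⟨m, rfl⟩ : ∃ m, n = m + 2 := ⟨n - 2, by omega⟩
  obtain ⟨c, hc1, hc2⟩ := hH.exists_fan (m + 1) (x 1) fun k => x (k + 2)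
  obtain ⟨P, hP1, hP2, hP3, hP4⟩ := (fanData_of_dist (m + 1) (by omega) (x 1)
    (fun k => x (k + 2)) c hH.1.le hc1 hc2).hasPlanarFan
  have hC : (((m + 1 : ℕ) : ℝ) - 1) * C = (((m + 2 : ℕ) : ℝ) - 2) * C := by push_cast; ring
  rw [hC] at hP4
  have hC0 : 0 ≤ (((m + 2 : ℕ) : ℝ) - 2) * C :=
    mul_nonneg (by push_cast; linarith [m.cast_nonneg (α := ℝ)]) hH.1.le
  set Φ := Complex.orthonormalBasisOneI.repr
  have hΦ : ∀ a b, dist (Φ a) (Φ b) = ‖a - b‖ := fun a b => by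
    rw [LinearIsometryEquiv.dist_map, dist_eq_norm]
  refine ⟨fun i => if i = 0 then Φ (P m) else if i = 1 then Φ 0 else Φ (P (i - 2)),
    hx, by simp, ?_, ?_, ?_⟩
  · intro i hi hin
    obtain ⟨i, rfl⟩ : ∃ i', i = i' + 1 := ⟨i - 1, by omega⟩
    rcases i with _ | _ | i
    · simp only [zero_add, one_ne_zero, if_true, if_false, hΦ, zero_sub,
        norm_neg]
      rw [hP1 m (Or.inl rfl) (by omega), hx]
    · simp [hP1 0 (Or.inr rfl) (by omega), dist_comm]
    · simp only [Nat.add_sub_cancel]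
      rw [if_neg (by omega), if_neg (by omega), if_neg (by omega), if_neg (by omega), hΦ,
        show i + 1 + 1 + 1 - 2 = i + 1 by omega, show i + 1 + 1 - 2 = i by omega, norm_sub_rev,
        hP2 i (by omega), dist_comm]
  · intro i hi hin
    obtain ⟨i, rfl⟩ : ∃ i', i = i' + 2 := ⟨i - 2, by omega⟩
    simpa [hΦ] using hP3 i (by omega)
  · have key : ∀ i j, i < j → j < m + 1 →
        dist (x (i + 2)) (x (j + 2)) ≤ dist (Φ (P i)) (Φ (P j)) + (((m + 2 : ℕ) : ℝ) - 2) * C :=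
      fun i j hij hj => by rw [hΦ]; exact hP4 i j hij hj
    intro i j hi hin hj hjn
    obtain ⟨i, rfl⟩ : ∃ i', i = i' + 2 := ⟨i - 2, by omega⟩
    obtain ⟨j, rfl⟩ : ∃ j', j = j' + 2 := ⟨j - 2, by omega⟩
    rw [if_neg (by omega), if_neg (by omega), if_neg (by omega), if_neg (by omega)]
    rcases lt_trichotomy i j with hij | rfl | hij
    · exact key i j hij (by omega)
    · simpa using hC0
    · rw [dist_comm, dist_comm (Φ _)]; exact key j i hij (by omega)

/-! ### From the `n`-point condition to rough CAT(0) -/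

open AffineMap in
theorem dist_lineMap_sq (A B U : Plane) (l : ℝ) : dist U (lineMap A B l) ^ 2
    = (1 - l) * dist A U ^ 2 + l * dist U B ^ 2 - l * (1 - l) * dist A B ^ 2 := by
  have e : U - lineMap A B l = (1 - l) • (U - A) + l • (U - B) := by
    rw [lineMap_apply_module]; module
  have f : A - B = (U - B) - (U - A) := by module
  rw [dist_comm A U, dist_eq_norm, dist_eq_norm, dist_eq_norm, dist_eq_norm, e, f,
    norm_add_sq_real, norm_sub_sq_real (U - B) (U - A), norm_smul, norm_smul,
    real_inner_smul_left, real_inner_smul_right, mul_pow, mul_pow, Real.norm_eq_abs,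
    Real.norm_eq_abs, sq_abs, sq_abs, real_inner_comm (U - A)]
  ring

open AffineMap in
theorem dist_lineMap_lineMap_sq (A B D : Plane) (l m : ℝ) :
    dist (lineMap A B l) (lineMap A D m) ^ 2
      = cevianSq l m (dist A B ^ 2) (dist A D ^ 2) (dist B D ^ 2) := by
  have e : lineMap A B l - lineMap A D m = m • (A - D) - l • (A - B) := by
    rw [lineMap_apply_module, lineMap_apply_module]; module
  have f : B - D = (A - D) - (A - B) := by module
  rw [dist_eq_norm, dist_eq_norm, dist_eq_norm, dist_eq_norm, e, f,
    norm_sub_sq_real (m • (A - D)), norm_sub_sq_real (A - D) (A - B), norm_smul, norm_smul,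
    real_inner_smul_left, real_inner_smul_right, mul_pow, mul_pow, Real.norm_eq_abs, Real.norm_eq_abs, sq_abs, sq_abs, cevianSq]
  ring

open AffineMap in
/-- A point of a path that is at most `h` longer than a segment is close to the corresponding point
of the segment. -/
theorem dist_lineMap_sq_le {A B U : Plane} {L K h l α β : ℝ} (hl : l ∈ Icc (0 : ℝ) 1)
    (hL : 0 ≤ L) (hLK : L ≤ K) (hα : 0 ≤ α) (hβ : 0 ≤ β) (hαβ : α + β ≤ h) (hAB : L ≤ dist A B)
    (h₁ : dist A U ≤ l * L + α) (h₂ : dist U B ≤ (1 - l) * L + β) :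
    dist U (lineMap A B l) ^ 2 ≤ 2 * l * (1 - l) * (K * h) + max l (1 - l) * h ^ 2 := by
  obtain ⟨hl0, hl1⟩ := hl
  have hl1' : 0 ≤ 1 - l := sub_nonneg.2 hl1
  rw [dist_lineMap_sq]
  -- In Stewart's identity the terms in `L²` cancel against `|A - B|² ≥ L²`. The cross terms give `2
  -- l (1 - l) L (α + β)`, and the squares of `α`, `β` the rest.
  have g1 := mul_le_mul_of_nonneg_left (pow_le_pow_left₀ dist_nonneg h₁ 2) hl1'
  have g2 := mul_le_mul_of_nonneg_left (pow_le_pow_left₀ dist_nonneg h₂ 2) hl0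
  have g3 := mul_le_mul_of_nonneg_left (pow_le_pow_left₀ hL hAB 2) (mul_nonneg hl0 hl1')
  have g4 : L * (α + β) ≤ K * h := mul_le_mul hLK hαβ (by positivity) (hL.trans hLK)
  have g5 := mul_le_mul_of_nonneg_left g4 (mul_nonneg hl0 hl1')
  have g6 := mul_le_mul_of_nonneg_right (le_max_right l (1 - l)) (sq_nonneg α)
  have g7 := mul_le_mul_of_nonneg_right (le_max_left l (1 - l)) (sq_nonneg β)
  have g8 : α ^ 2 + β ^ 2 ≤ h ^ 2 := by
    have := pow_le_pow_left₀ (add_nonneg hα hβ) hαβ 2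
    nlinarith [mul_nonneg hα hβ]
  have g9 := mul_le_mul_of_nonneg_left g8 (hl0.trans (le_max_left l (1 - l)))
  linarith

/-- The coefficients `l (l - m)` and `m (m - l)` are not both positive. Only the side with
nonnegative coefficient, which is at most `1`, can increase the value. -/
theorem cevianSq_le_add {l m a b a' b' c h K : ℝ} (hl : l ∈ Icc (0 : ℝ) 1)
    (hm : m ∈ Icc (0 : ℝ) 1) (ha : 0 ≤ a) (hb : 0 ≤ b) (hh : 0 ≤ h) (haK : a ≤ K) (hbK : b ≤ K)
    (h₁ : a ≤ a') (h₂ : a' ≤ a + h) (h₃ : b ≤ b') (h₄ : b' ≤ b + h) :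
    cevianSq l m (a' ^ 2) (b' ^ 2) c ≤ cevianSq l m (a ^ 2) (b ^ 2) c + (2 * (K * h) + h ^ 2) := by
  have key : ∀ s t p q p' q' : ℝ, s ∈ Icc (0 : ℝ) 1 → t ∈ Icc (0 : ℝ) 1 → t ≤ s → 0 ≤ p → 0 ≤ q →
      p ≤ K → p ≤ p' → p' ≤ p + h → q ≤ q' → s * (s - t) * p' ^ 2 + t * (t - s) * q' ^ 2
        ≤ s * (s - t) * p ^ 2 + t * (t - s) * q ^ 2 + (2 * (K * h) + h ^ 2) := by
    intro s t p q p' q' hs ht hts hp hq hpK h1 h2 h3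
    have e1 := mul_le_mul_of_nonneg_left (pow_le_pow_left₀ hq h3 2)
      (mul_nonneg ht.1 (sub_nonneg.2 hts))
    have e2 : p' ^ 2 - p ^ 2 ≤ 2 * (K * h) + h ^ 2 := by
      have := pow_le_pow_left₀ (hp.trans h1) h2 2
      have := mul_le_mul_of_nonneg_right hpK hh
      nlinarith
    have e3 : 0 ≤ p' ^ 2 - p ^ 2 := sub_nonneg.2 (pow_le_pow_left₀ hp h1 2)
    have e4 : s * (s - t) ≤ 1 := mul_le_one₀ hs.2 (sub_nonneg.2 hts) (by linarith [hs.2, ht.1])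
    have e5 := mul_le_mul_of_nonneg_right e4 e3
    linarith
  unfold cevianSq
  rcases le_total m l with h | h
  · linarith [key l m a b a' b' hl hm h ha hb haK h₁ h₂ h₃]
  · linarith [key m l b a b' a' hm hl h hb ha hbK h₃ h₄ h₁]

/-- For `n > 5` the last point `v` is repeated; its images coincide since consecutive distances are
exact. Starting at `x` yields the diagonal bounds from `x` without error. -/
theorem RoughNPointCondition.exists_pentagon {X : Type*} [MetricSpace X] {n : ℕ} {C : ℝ}
    (hX : RoughNPointCondition X n C) (hn : 5 ≤ n) (x u y z v : X) :
    ∃ A U B D V : Plane, dist A U = dist x u ∧ dist U B = dist u y ∧ dist B D = dist y z ∧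
      dist D V = dist z v ∧ dist V A = dist v x ∧ dist x y ≤ dist A B ∧ dist x z ≤ dist A D ∧
      dist u v ≤ dist U V + C := by
  obtain ⟨f, hf⟩ : ∃ f : ℕ → X, f = fun k =>
      match k with | 1 => x | 2 => u | 3 => y | 4 => z | _ => v := ⟨_, rfl⟩
  have hfv : ∀ k, 5 ≤ k → f k = v := by
    intro k hk
    obtain ⟨k, rfl⟩ : ∃ k', k = k' + 5 := ⟨k - 5, by omega⟩
    subst hf; rfl
  have f0 : f 0 = v := by subst hf; rfl
  have f1 : f 1 = x := by subst hf; rfl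
  have f2 : f 2 = u := by subst hf; rfl
  have f3 : f 3 = y := by subst hf; rfl
  have f4 : f 4 = z := by subst hf; rfl
  have f5 : f 5 = v := hfv 5 le_rfl
  obtain ⟨g, hg⟩ := hX f (by rw [f0, hfv n hn])
  have hg5 : ∀ k, 5 ≤ k → k ≤ n → g k = g 5 := by
    intro k hk
    induction k, hk using Nat.le_induction with
    | base => intro; rfl
    | succ k hk ih =>
      intro hkn
      have := hg.dist_side (k + 1) (by omega) hkn
      rw [Nat.add_sub_cancel, hfv (k + 1) (by omega), hfv k hk, dist_self] at this
      rw [dist_eq_zero.1 this.symm, ih (by omega)]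
  have s1 := hg.dist_side 1 le_rfl (by omega)
  have s2 := hg.dist_side 2 (by omega) (by omega)
  have s3 := hg.dist_side 3 (by omega) (by omega)
  have s4 := hg.dist_side 4 (by omega) (by omega)
  have s5 := hg.dist_side 5 (by omega) (by omega)
  have t3 := hg.dist_first 3 (by omega) (by omega)
  have t4 := hg.dist_first 4 (by omega) (by omega)
  have r := hg.dist_rough 2 5 le_rfl (by omega) (by omega) hn
  norm_num [f0, f1, f2, f3, f4, f5] at s1 s2 s3 s4 s5 t3 t4 r
  rw [hg.closed_bar, hg5 n hn le_rfl] at s1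
  refine ⟨g 1, g 2, g 3, g 4, g 5, ?_, ?_, ?_, ?_, ?_, t3, t4, r⟩
  · rw [dist_comm, ← s2, dist_comm]
  · rw [dist_comm, ← s3, dist_comm]
  · rw [dist_comm, ← s4, dist_comm]
  · rw [dist_comm, ← s5, dist_comm]
  · rw [dist_comm, ← s1, dist_comm]

open AffineMap in
/-- The comparison of a rough pentagon `x u y z v`, with `u` and `v` near the sides `[x, y]` and
`[x, z]`, with the triangle `a b c`. -/
theorem RoughNPointCondition.dist_le {X : Type*} [MetricSpace X] {n : ℕ} {C : ℝ}
    (hX : RoughNPointCondition X n C) (hn : 5 ≤ n) {x u y z v : X} {a b c : Plane}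
    {h K l m α β α' β' : ℝ} (hl : l ∈ Icc (0 : ℝ) 1) (hm : m ∈ Icc (0 : ℝ) 1)
    (hab : dist a b = dist x y) (hac : dist a c = dist x z) (hbc : dist b c = dist y z)
    (hxy : dist x y ≤ K) (hxz : dist x z ≤ K) (hyz : dist y z ≤ K)
    (hα : 0 ≤ α) (hβ : 0 ≤ β) (hαβ : α + β ≤ h)
    (hα' : 0 ≤ α') (hβ' : 0 ≤ β') (hαβ' : α' + β' ≤ h)
    (hxu : dist x u ≤ l * dist x y + α) (huy : dist u y ≤ (1 - l) * dist x y + β)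
    (hxv : dist x v ≤ m * dist x z + α') (hvz : dist v z ≤ (1 - m) * dist x z + β') :
    dist u v ≤ (3 * K + 2 * h) / 2 + C ∧
    ∀ F G : ℝ, (∀ s ∈ Icc (0 : ℝ) 1, 2 * s * (1 - s) * (K * h) + max s (1 - s) * h ^ 2 ≤ F) →
      2 * (K * h) + h ^ 2 ≤ G →
      dist u v ≤ dist (lineMap a b l) (lineMap a c m) + (C + (2 * √F + √G)) := by
  obtain ⟨A, U, B, D, V, e1, e2, e3, e4, e5, e6, e7, e8⟩ := hX.exists_pentagon hn x u y z v
  rw [dist_comm D V, dist_comm z v] at e4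
  rw [dist_comm V A, dist_comm v x] at e5
  constructor
  -- `|U - V|` is at most half the perimeter of the pentagon.
  · have g1 := dist_triangle_left U V A
    have g2 := dist_triangle4 U B D V
    rw [dist_comm D V] at g2
    linarith
  · intro F G hF hG
    have n1 := dist_lineMap_sq_le (U := U) (A := A) (B := B) hl dist_nonneg hxy hα hβ hαβ e6
      (e1.trans_le hxu) (e2.trans_le huy)
    have n2 := dist_lineMap_sq_le (U := V) (A := A) (B := D) hm dist_nonneg hxz hα' hβ' hαβ' e7
      (e5.trans_le hxv) (e4.trans_le hvz)
    have n1' := Real.le_sqrt_of_sq_le (n1.trans (hF l hl))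
    have n2' := Real.le_sqrt_of_sq_le (n2.trans (hF m hm))
    have n3 : dist (lineMap A B l) (lineMap A D m) ^ 2
        ≤ dist (lineMap a b l) (lineMap a c m) ^ 2 + G := by
      rw [dist_lineMap_lineMap_sq, dist_lineMap_lineMap_sq, hab, hac, hbc, e3]
      refine (cevianSq_le_add hl hm dist_nonneg dist_nonneg (by linarith) hxy hxz e6 ?_ e7 ?_).trans
        (add_le_add_right hG _)
      · have := dist_triangle A U B
        linarith
      · have := dist_triangle A V D
        linarith
    have hG0 : 0 ≤ G := by
      have : 0 ≤ K := dist_nonneg.trans hxy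
      have : 0 ≤ h := by linarith
      exact le_trans (by positivity) hG
    have n4 : dist (lineMap A B l) (lineMap A D m)
        ≤ dist (lineMap a b l) (lineMap a c m) + √G := by
      refine abs_le_of_sq_le_sq' ?_ (by positivity) |>.2
      have := mul_nonneg (dist_nonneg (x := (lineMap a b l : Plane)) (y := lineMap a c m))
        (Real.sqrt_nonneg G)
      have := Real.sq_sqrt hG0
      linarith [add_sq (dist (lineMap a b l : Plane) (lineMap a c m)) √G]
    have := dist_triangle4 U (lineMap A B l) (lineMap A D m) V
    rw [dist_comm (lineMap A D m) V] at this
    linarith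

open AffineMap in
-- `α` and `β` are the excesses of the two subpath lengths over the two parts of the segment. They
-- are nonnegative by definition of a comparison point, and their sum is the total excess, at most
-- `h`.
theorem ShortSegment.IsComparisonPoint.exists_lineMap {X : Type*} [MetricSpace X] {h : ℝ} {x y : X}
    {γ : ShortSegment h x y} {t : ℝ} {a b q : Plane} (hq : γ.IsComparisonPoint t a b q)
    (hh : 0 ≤ h) (ht : t ∈ Icc 0 γ.L) (hab : dist a b = dist x y) :
    ∃ l ∈ Icc (0 : ℝ) 1, ∃ α β : ℝ, 0 ≤ α ∧ 0 ≤ β ∧ α + β ≤ h ∧ q = lineMap a b l ∧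
      dist x (γ.toFun t) ≤ l * dist x y + α ∧ dist (γ.toFun t) y ≤ (1 - l) * dist x y + β := by
  obtain ⟨hseg, h1, h2⟩ := hq
  rw [segment_eq_image_lineMap] at hseg
  obtain ⟨l, hl, rfl⟩ := hseg
  have hadd : eVariationOn γ.toFun (Icc 0 t) + eVariationOn γ.toFun (Icc t γ.L)
      ≤ ENNReal.ofReal (dist x y + h) := by
    have := eVariationOn.Icc_add_Icc γ.toFun (s := univ) ht.1 ht.2 (mem_univ t)
    simp only [univ_inter] at this
    rw [this, ENNReal.ofReal_add dist_nonneg hh, ← edist_dist]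
    exact γ.length_le
  have h3 := γ.edist_source_le ht
  have h4 := γ.edist_target_le ht
  set S := eVariationOn γ.toFun (Icc 0 t)
  set S' := eVariationOn γ.toFun (Icc t γ.L)
  have hS : S ≠ ⊤ := ne_top_of_le_ne_top ENNReal.ofReal_ne_top (le_self_add.trans hadd)
  have hS' : S' ≠ ⊤ := ne_top_of_le_ne_top ENNReal.ofReal_ne_top (le_add_self.trans hadd)
  have hsum : S.toReal + S'.toReal ≤ dist x y + h := by
    rw [← ENNReal.toReal_add hS hS']
    exact ENNReal.toReal_le_of_le_ofReal (by positivity) hadd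
  have conv : ∀ {Y : Type _} [PseudoMetricSpace Y] {p q : Y} {T : ENNReal}, T ≠ ⊤ →
      edist p q ≤ T → dist p q ≤ T.toReal := by
    intro Y _ p q T hT h
    rw [dist_edist]
    exact ENNReal.toReal_mono hT h
  have h1 := conv hS h1
  have h2 : dist (lineMap a b l : Plane) b ≤ S'.toReal := by
    rw [dist_edist]; exact ENNReal.toReal_mono hS' h2
  rw [dist_left_lineMap, Real.norm_of_nonneg hl.1, hab] at h1
  rw [dist_lineMap_right, Real.norm_of_nonneg (sub_nonneg.2 hl.2), hab] at h2
  refine ⟨l, hl, S.toReal - l * dist x y, S'.toReal - (1 - l) * dist x y, by linarith,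
    by linarith, by linarith, rfl, ?_, ?_⟩
  · rw [add_sub_cancel, dist_edist]; exact ENNReal.toReal_mono hS h3
  · rw [add_sub_cancel, dist_edist]; exact ENNReal.toReal_mono hS' h4

/-- The rough CAT(0) condition follows from the one for consecutive sides. -/
theorem isRoughCAT0With_of_consecutive {X : Type*} [MetricSpace X] {C : ℝ} {H : X → X → X → ℝ}
    (hC : 0 < C) (hX : IsLengthSpace X) (hH : ∀ x y z, 0 < H x y z)
    (h : ∀ (p : Fin 3 → X)
      (σ : ∀ i : Fin 3, ShortSegment (H (p 0) (p 1) (p 2)) (p i) (p (i + 1)))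
      (pbar : Fin 3 → Plane), (∀ i j, dist (pbar i) (pbar j) = dist (p i) (p j)) →
      ∀ i : Fin 3, ∀ s ∈ Icc 0 (σ i).L, ∀ t ∈ Icc 0 (σ (i + 1)).L, ∀ ubar vbar : Plane,
        (σ i).IsComparisonPoint s (pbar i) (pbar (i + 1)) ubar →
        (σ (i + 1)).IsComparisonPoint t (pbar (i + 1)) (pbar (i + 1 + 1)) vbar →
        dist ((σ i).toFun s) ((σ (i + 1)).toFun t) ≤ dist ubar vbar + C) :
    IsRoughCAT0With X C H := by
  refine ⟨hC, hX, hH, fun p σ pbar hp i j hij s hs t ht u v hu hv => ?_⟩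
  obtain rfl | rfl : j = i + 1 ∨ i = j + 1 :=
    (by decide : ∀ i j : Fin 3, i ≠ j → j = i + 1 ∨ i = j + 1) i j hij
  · exact h p σ pbar hp i s hs t ht u v hu hv
  · rw [dist_comm, dist_comm u]
    exact h p σ pbar hp j t ht s hs v u hv hu

open AffineMap in
theorem RoughNPointCondition.dist_side_le {X : Type*} [MetricSpace X] {n : ℕ} {C : ℝ}
    (hX : RoughNPointCondition X n C) (hn : 5 ≤ n) {h K : ℝ} (hh : 0 ≤ h) {p : Fin 3 → X}
    (hK : ∀ i j, dist (p i) (p j) ≤ K) (σ : ∀ i : Fin 3, ShortSegment h (p i) (p (i + 1)))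
    {pbar : Fin 3 → Plane} (hp : ∀ i j, dist (pbar i) (pbar j) = dist (p i) (p j)) (i : Fin 3)
    {s t : ℝ} (hs : s ∈ Icc 0 (σ i).L) (ht : t ∈ Icc 0 (σ (i + 1)).L) {ubar vbar : Plane}
    (hu : (σ i).IsComparisonPoint s (pbar i) (pbar (i + 1)) ubar)
    (hv : (σ (i + 1)).IsComparisonPoint t (pbar (i + 1)) (pbar (i + 1 + 1)) vbar) :
    dist ((σ i).toFun s) ((σ (i + 1)).toFun t) ≤ (3 * K + 2 * h) / 2 + C ∧
    ∀ F G : ℝ, (∀ s ∈ Icc (0 : ℝ) 1, 2 * s * (1 - s) * (K * h) + max s (1 - s) * h ^ 2 ≤ F) →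
      2 * (K * h) + h ^ 2 ≤ G →
      dist ((σ i).toFun s) ((σ (i + 1)).toFun t) ≤ dist ubar vbar + (C + (2 * √F + √G)) := by
  obtain ⟨l, hl, α, β, hα, hβ, hαβ, rfl, l1, l2⟩ := hu.exists_lineMap hh hs (hp _ _)
  obtain ⟨m, hm, α', β', hα', hβ', hαβ', rfl, m1, m2⟩ := hv.exists_lineMap hh ht (hp _ _)
  -- The common vertex `p (i + 1)` is the end of the first side, so the fraction on that side
  -- becomes `1 - l` and the excesses trade places.
  have := hX.dist_le hn (x := p (i + 1)) (y := p i) (z := p (i + 1 + 1)) (u := (σ i).toFun s)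
    (v := (σ (i + 1)).toFun t) (l := 1 - l) (m := m) (h := h) (K := K) (α := β) (β := α)
    ⟨by linarith [hl.2], by linarith [hl.1]⟩ hm (hp _ _) (hp _ _) (hp _ _) (hK _ _) (hK _ _)
    (hK _ _) hβ hα (by linarith) hα' hβ' hαβ'
    (by rw [dist_comm, dist_comm (p (i + 1))]; exact l2)
    (by rw [dist_comm, dist_comm (p (i + 1)), sub_sub_cancel]; exact l1) m1 m2
  rwa [lineMap_apply_one_sub] at this

theorem dist_le_one_sup {X : Type*} [MetricSpace X] (p : Fin 3 → X) (i j : Fin 3) :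
    dist (p i) (p j) ≤ 1 ⊔ dist (p 0) (p 1) ⊔ dist (p 0) (p 2) ⊔ dist (p 1) (p 2) := by
  obtain ⟨K, hKdef⟩ : ∃ K, K = 1 ⊔ dist (p 0) (p 1) ⊔ dist (p 0) (p 2) ⊔ dist (p 1) (p 2) :=
    ⟨_, rfl⟩
  rw [← hKdef]
  have h01 : dist (p 0) (p 1) ≤ K := by simp [hKdef]
  have h02 : dist (p 0) (p 2) ≤ K := by simp [hKdef]
  have h12 : dist (p 1) (p 2) ≤ K := by simp [hKdef]
  have h0 : 0 ≤ K := dist_nonneg.trans h01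
  fin_cases i <;> fin_cases j <;> simp [h01, h02, h12, h0, dist_comm (p 1) (p 0),
    dist_comm (p 2) (p 0), dist_comm (p 2) (p 1)]

/-- Here `K h = 1`. For `K ≥ 3/2` one may take `F = 3/4` and `G = 3`, and `2√F + √G = 2√3`. For
smaller `K` this `F` can fail, but the half perimeter is then at most `13/4 < 2√3`. -/
theorem RoughNPointCondition.isRoughCAT0 {X : Type*} [MetricSpace X] (hL : IsLengthSpace X)
    {n : ℕ} {C : ℝ} (hC : 0 ≤ C) (hX : RoughNPointCondition X n C) (hn : 5 ≤ n) :
    IsRoughCAT0 X (C + 2 * √3) := by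
  refine isRoughCAT0With_of_consecutive (by positivity) hL (fun x y z => by positivity) ?_
  intro p
  set K := 1 ⊔ dist (p 0) (p 1) ⊔ dist (p 0) (p 2) ⊔ dist (p 1) (p 2) with hKdef
  intro σ pbar hp i s hs t ht u v hu hv
  have hK1 : 1 ≤ K := by simp [hKdef]
  have hK : ∀ i j, dist (p i) (p j) ≤ K := dist_le_one_sup p
  have hKpos : 0 < K := by linarith
  obtain ⟨half, near⟩ := hX.dist_side_le hn (by positivity) hK σ hp i hs ht hu hv
  have hKh : K * (1 / K) = 1 := mul_one_div_cancel hKpos.ne'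
  have h3 : (0 : ℝ) < √3 := by positivity
  have hs3 : √3 ^ 2 = (3 : ℝ) := Real.sq_sqrt (by norm_num)
  rcases le_total K (3 / 2) with hK2 | hK2
  · have h1 : 1 / K ≤ 1 := (div_le_one hKpos).2 hK1
    have h2 : (17 / 10 : ℝ) ≤ √3 := Real.le_sqrt_of_sq_le (by norm_num)
    have h4 : 0 ≤ dist u v := dist_nonneg
    linarith
  · have h1 : 1 / K ≤ 2 / 3 := by rw [div_le_div_iff₀ hKpos (by norm_num)]; linarith
    have h2 : (1 / K) ^ 2 ≤ 4 / 9 :=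
      (pow_le_pow_left₀ (by positivity) h1 2).trans (by norm_num)
    have := near (3 / 4) 3 (fun s hs => by
      rw [hKh]
      have h5 := mul_le_mul_of_nonneg_left h2 (hs.1.trans (le_max_left s (1 - s)))
      rcases le_total s (1 - s) with h | h
      · rw [max_eq_right h] at h5 ⊢
        nlinarith [sq_nonneg (s - 7 / 18)]
      · rw [max_eq_left h] at h5 ⊢
        nlinarith [sq_nonneg (s - 11 / 18)]) (by rw [hKh]; linarith)
    have h6 : √(3 / 4 : ℝ) = √3 / 2 := by
      rw [Real.sqrt_eq_iff_mul_self_eq (by norm_num) (by positivity)]; linarith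
    rw [h6] at this
    linarith

theorem RoughNPointCondition.isRoughCAT0Star {X : Type*} [MetricSpace X] (hL : IsLengthSpace X)
    {n : ℕ} {C C' : ℝ} (hC : 0 ≤ C) (hX : RoughNPointCondition X n C) (hn : 5 ≤ n) (hCC' : C < C') :
    IsRoughCAT0Star X C' := by
  set ε := C' - C with hε
  have hε0 : 0 < ε := sub_pos.2 hCC'
  -- With `K h = δ` both `F` and `G` are bounded by `3δ ≤ (ε/3)²`, so the three roots add up to at
  -- most `ε`.
  obtain ⟨δ, hδ0, hδ1, hδε⟩ : ∃ δ : ℝ, 0 < δ ∧ δ ≤ 1 ∧ δ ≤ ε ^ 2 / 27 :=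
    ⟨min 1 (ε ^ 2 / 27), by positivity, min_le_left _ _, min_le_right _ _⟩
  refine ⟨fun x y z => δ / (1 ⊔ dist x y ⊔ dist x z ⊔ dist y z),
    isRoughCAT0With_of_consecutive (by linarith) hL (fun x y z => by positivity) ?_⟩
  intro p
  set K := 1 ⊔ dist (p 0) (p 1) ⊔ dist (p 0) (p 2) ⊔ dist (p 1) (p 2) with hKdef
  intro σ pbar hp i s hs t ht u v hu hv
  have hK1 : 1 ≤ K := by simp [hKdef]
  have hK : ∀ i j, dist (p i) (p j) ≤ K := dist_le_one_sup p
  have hKpos : 0 < K := by linarith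
  obtain ⟨-, near⟩ := hX.dist_side_le hn (by positivity) hK σ hp i hs ht hu hv
  have hKh : K * (δ / K) = δ := mul_div_cancel₀ δ hKpos.ne'
  have h1 : δ / K ≤ δ := div_le_self hδ0.le hK1
  have h2 : (δ / K) ^ 2 ≤ δ := by
    have := pow_le_pow_left₀ (by positivity) h1 2
    nlinarith
  have := near ((ε / 3) ^ 2) ((ε / 3) ^ 2) (fun s hs => by
    rw [hKh]
    have h5 : max s (1 - s) * (δ / K) ^ 2 ≤ 1 * δ :=
      mul_le_mul (max_le hs.2 (by linarith [hs.1])) h2 (sq_nonneg _) zero_le_one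
    have h6 : 2 * s * (1 - s) ≤ 2 := by nlinarith [hs.1, hs.2]
    have h7 := mul_le_mul_of_nonneg_right h6 hδ0.le
    linarith) (by rw [hKh]; linarith)
  rw [Real.sqrt_sq (by positivity)] at this
  linarith

theorem theoremT {X : Type*} [MetricSpace X] (hX : IsLengthSpace X) :
    (∀ n : ℕ, 5 ≤ n → ∀ C : ℝ, 0 ≤ C → RoughNPointCondition X n C →
      IsRoughCAT0 X (C + 2 * √3) ∧ ∀ C'' : ℝ, C < C'' → IsRoughCAT0Star X C'') ∧
    (∀ C₀ : ℝ, 0 < C₀ → IsRoughCAT0Star X C₀ →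
      ∀ n : ℕ, 3 ≤ n → RoughNPointCondition X n (((n : ℝ) - 2) * C₀)) :=
  ⟨fun _ hn _ hC h => ⟨h.isRoughCAT0 hX hC hn, fun _ hCC' => h.isRoughCAT0Star hX hC hn hCC'⟩,
    fun _ _ h _ hn => h.roughNPointCondition hn⟩
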